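/- Let $k$ be an algebraically closed field, let $N$ be a lattice (a free abelian group of finite rank) with dual lattice $M=\operatorname{Hom}(N,\mathbb{Z})$, and let $\Delta$ be a fan in $N$, that is, a finite nonempty collection of strongly convex rational polyhedral cones in $N_{\mathbb{R}}=N\otimes_{\mathbb Z}\mathbb{R}$ that is closed under taking faces and in which any two cones intersect along a common face. Assume that $\Delta$ is non-degenerate, i.e. not contained in a proper subspace of $N_{\mathbb{R}}$. Let $X=X(\Delta)$ be the toric variety over $k$ glued from the affine charts $U_\sigma=\operatorname{Spec} k[\sigma^\vee\cap M]$, $\sigma\in\Delta$, along the open subschemes $U_{\sigma\cap\tau}$, and let $T=\operatorname{Spec} k[M]$ be its torus. For $u\in M$ let $x^u$ be the corresponding character, regarded as a rational function on $X$. Let $v_1,\dots,v_d\in N$ be the primitive generators of the rays of $\Delta$, and for each $i$ let $Y(v_i)$ be the prime divisor of $X$ whose ideal in the chart of the ray spanned by $v_i$ is generated by the $x^u$ with $\langle u,v_i\rangle>0$. Let $\operatorname{Cl}(X)$ be the group of Weil divisors modulo principal divisors, and let $\operatorname{Cox}(X)=k[v_1,\dots,v_d]$ be the polynomial ring with one variable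 for each ray, graded by $\operatorname{Cl}(X)$ via $\deg(v_i)=[Y(v_i)]$. Let $D$ be a $T$-invariant Weil divisor on $X$, let $a_i$ be the coefficient of $Y(v_i)$ in $D$, and let $$H^0(X,\mathcal O(D))=\{f\in k(X)\;:\; f=0\ \text{ or }\ \operatorname{div}(f)+D\ge 0\}$$ be the space of global sections of the sheaf associated to $D$. Then $H^0(X,\mathcal O(D))$ is isomorphic, as a $k$-vector space, to the graded piece $\operatorname{Cox}(X)_{[D]}$ of degree $[D]\in\operatorname{Cl}(X)$. More precisely, there is a unique $k$-linear isomorphism $$H^0(X,\mathcal O(D))\;\longrightarrow\;\operatorname{Cox}(X)_{[D]}$$ that sends every character $x^u$ ($u\in M$) with $\operatorname{div}(x^u)+D\ge 0$ to the monomial $\prod_{i=1}^d v_i^{\langle u,v_i\rangle+a_i}$, all of whose exponents are nonnegative. -/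

import Mathlib

noncomputable section

namespace Toric

open CategoryTheory CategoryTheory.Limits AlgebraicGeometry
open scoped TensorProduct

universe u


section Cones

variable (N : Type) [AddCommGroup N]

/-- `N_ℝ = ℝ ⊗ N`. -/
abbrev RealSpan : Type := ℝ ⊗[ℤ] N

/-- The dual lattice `M = Hom(N, ℤ)`. -/
abbrev DualLattice : Type := Module.Dual ℤ N

variable {N}

/-- The image of a lattice vector in `N_ℝ`. -/
def toReal (v : N) : RealSpan N := (1 : ℝ) ⊗ₜ[ℤ] v

/-- The real linear functional on `N_ℝ` that extends `u ∈ M`. -/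
def realFunctional (u : DualLattice N) : RealSpan N →ₗ[ℝ] ℝ :=
  Module.Dual.baseChange ℝ u

/-- The rational polyhedral cones: positive spans of finitely many lattice vectors. -/
def IsRationalPolyhedral (σ : PointedCone ℝ (RealSpan N)) : Prop :=
  ∃ S : Finset N, σ = PointedCone.hull ℝ (toReal '' (S : Set N))

/-- `τ` is the face of `σ` cut out by a supporting hyperplane `w = 0`; `w = 0` is allowed, so that
a cone is a face of itself. -/
def IsFace (τ σ : PointedCone ℝ (RealSpan N)) : Prop :=
  ∃ w : RealSpan N →ₗ[ℝ] ℝ, (∀ x ∈ σ, 0 ≤ w x) ∧ ∀ x, x ∈ τ ↔ x ∈ σ ∧ w x = 0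

/-- The semigroup `σ^∨ ∩ M`. -/
def dualMonoid (σ : PointedCone ℝ (RealSpan N)) : AddSubmonoid (DualLattice N) where
  carrier := {u | ∀ x ∈ σ, 0 ≤ realFunctional u x}
  zero_mem' := by intro x _; simp [realFunctional]
  add_mem' := by
    intro a b ha hb x hx
    have h : realFunctional (a + b) x = realFunctional a x + realFunctional b x := by
      simp [realFunctional]
    rw [h]; exact add_nonneg (ha x hx) (hb x hx)

variable (N) in
/-- A fan in the lattice `N`: a finite collection of rational polyhedral cones which is closed under
taking faces and in which any two cones meet along a common face. The condition `{0} ∈ Δ` says that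
the fan is nonempty and that its cones are strongly convex, i.e. contain no line. -/
structure Fan where
  cones : Set (PointedCone ℝ (RealSpan N))
  finite : cones.Finite
  bot_mem : ⊥ ∈ cones
  rational : ∀ σ ∈ cones, IsRationalPolyhedral σ
  face_mem : ∀ σ ∈ cones, ∀ τ, IsFace τ σ → τ ∈ cones
  inter_face : ∀ σ ∈ cones, ∀ τ ∈ cones, IsFace (σ ⊓ τ) σ ∧ IsFace (σ ⊓ τ) τ

/-- The fan is not contained in a proper subspace of `N_ℝ`. -/
def Fan.IsNondegenerate (Δ : Fan N) : Prop :=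
  Submodule.span ℝ (⋃ σ ∈ Δ.cones, (σ : Set (RealSpan N))) = ⊤

@[simp] lemma realFunctional_toReal (u : DualLattice N) (v : N) :
    realFunctional u (toReal v) = (u v : ℝ) := by
  simp [realFunctional, toReal]

lemma realFunctional_add (u w : DualLattice N) (x : RealSpan N) :
    realFunctional (u + w) x = realFunctional u x + realFunctional w x := by
  simp [realFunctional]

lemma realFunctional_nsmul (n : ℕ) (u : DualLattice N) (x : RealSpan N) :
    realFunctional (n • u) x = n * realFunctional u x := by
  induction n with
  | zero => simp [realFunctional]
  | succ n ih => rw [succ_nsmul, realFunctional_add, ih]; push_cast; ring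

lemma nonneg_on_hull {S : Set N} {w : RealSpan N →ₗ[ℝ] ℝ}
    (h : ∀ s ∈ S, 0 ≤ w (toReal s)) :
    ∀ x ∈ PointedCone.hull ℝ (toReal '' S), 0 ≤ w x := by
  intro x hx
  induction hx using Submodule.span_induction with
  | mem x hx => obtain ⟨s, hs, rfl⟩ := hx; exact h s hs
  | zero => simp
  | add x y _ _ hx hy => rw [map_add]; exact add_nonneg hx hy
  | smul a x _ hx =>
    rw [LinearMap.map_smul_of_tower]
    exact smul_nonneg a.2 hx

lemma toReal_mem_hull {S : Set N} {s : N} (hs : s ∈ S) :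
    toReal s ∈ PointedCone.hull ℝ (toReal '' S) :=
  Submodule.subset_span ⟨s, hs, rfl⟩

lemma mem_dualMonoid_hull {S : Set N} {u : DualLattice N} :
    u ∈ dualMonoid (PointedCone.hull ℝ (toReal '' S)) ↔ ∀ s ∈ S, 0 ≤ u s := by
  constructor
  · intro h s hs
    have := h _ (toReal_mem_hull hs)
    rw [realFunctional_toReal] at this
    exact_mod_cast this
  · intro h
    apply nonneg_on_hull
    intro s hs
    rw [realFunctional_toReal]
    exact_mod_cast h s hs

/-- A point of the hull on which a nonnegative functional vanishes is in the hull of those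
generators on which it vanishes. -/
lemma mem_hull_of_eq_zero {S : Set N} {w : RealSpan N →ₗ[ℝ] ℝ}
    (h : ∀ s ∈ S, 0 ≤ w (toReal s)) :
    ∀ x ∈ PointedCone.hull ℝ (toReal '' S), w x = 0 →
      x ∈ PointedCone.hull ℝ (toReal '' {s ∈ S | w (toReal s) = 0}) := by
  intro x hx
  induction hx using Submodule.span_induction with
  | mem x hx => obtain ⟨s, hs, rfl⟩ := hx; intro h0; exact toReal_mem_hull ⟨hs, h0⟩
  | zero => intro _; exact zero_mem _
  | add x y hx' hy' hx hy =>
    intro h0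
    rw [map_add] at h0
    have h1 := nonneg_on_hull h x hx'
    have h2 := nonneg_on_hull h y hy'
    exact add_mem (hx (by linarith)) (hy (by linarith))
  | smul a x hx' hx =>
    intro h0
    rw [LinearMap.map_smul_of_tower] at h0
    by_cases ha : a = 0
    · subst ha; rw [zero_smul]; exact zero_mem _
    · apply Submodule.smul_mem
      apply hx
      have : (a : ℝ) * w x = 0 := h0
      rcases mul_eq_zero.1 this with h | h
      · exact absurd (Subtype.ext h) ha
      · exact h

/-- A functional with rational signs: there is a lattice functional with the same sign on each of
finitely many lattice vectors on which the given real functional is nonnegative. -/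
lemma exists_integral_functional [Module.Finite ℤ N] (S : Finset N) (w : RealSpan N →ₗ[ℝ] ℝ)
    (h : ∀ s ∈ S, 0 ≤ w (toReal s)) :
    ∃ u : DualLattice N, (∀ s ∈ S, 0 ≤ u s) ∧ ∀ s ∈ S, u s = 0 ↔ w (toReal s) = 0 := by
  classical
  let f : N →ₗ[ℤ] ℝ := (w.restrictScalars ℤ) ∘ₗ (TensorProduct.mk ℤ ℝ N 1)
  have hf : ∀ s, f s = w (toReal s) := fun s => rfl
  let A := LinearMap.range f
  have : Module.Finite ℤ A := Module.Finite.range f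
  let b := Module.Free.chooseBasis ℤ A
  let ι := Module.Free.ChooseBasisIndex ℤ A
  let c : ι → DualLattice N := fun j => b.coord j ∘ₗ f.rangeRestrict
  have hc : ∀ s, f s = ∑ j, (c j s : ℝ) * (b j : ℝ) := by
    intro s
    have := congrArg (Subtype.val) (b.sum_repr (f.rangeRestrict s))
    simp only [AddSubmonoidClass.coe_finsetSum] at this
    rw [show f s = ((f.rangeRestrict s : A) : ℝ) from rfl, ← this]
    simp [c, zsmul_eq_mul, ι]
  have hc0 : ∀ s, f s = 0 → ∀ j, c j s = 0 := by
    intro s hs j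
    have : f.rangeRestrict s = 0 := Subtype.ext hs
    simp [c, this]
  let O : Set (ι → ℝ) := ⋂ s ∈ S.filter (fun s => 0 < f s), {q | 0 < ∑ j, (c j s : ℝ) * q j}
  have hO : IsOpen O := by
    apply isOpen_biInter_finset
    intro s _
    exact isOpen_lt continuous_const (by fun_prop)
  have hne : (fun j => (b j : ℝ)) ∈ O := by
    simp only [O, Set.mem_iInter, Finset.mem_filter]
    rintro s ⟨_, hs⟩
    change 0 < ∑ j, (c j s : ℝ) * (b j : ℝ)
    rw [← hc]; exact hs
  have hd : DenseRange (Pi.map (fun (_ : ι) (x : ℚ) => (x : ℝ))) :=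
    DenseRange.piMap (fun _ => Rat.denseRange_cast)
  obtain ⟨q, hq⟩ := hd.exists_mem_open hO ⟨_, hne⟩
  let d : ℤ := ∏ j, ((q j).den : ℤ)
  have hdpos : 0 < d := Finset.prod_pos fun j _ => by exact_mod_cast (q j).den_pos
  have hn : ∀ j, ∃ n : ℤ, (n : ℝ) = d * (q j : ℝ) := by
    intro j
    obtain ⟨e, he⟩ : ((q j).den : ℤ) ∣ d := Finset.dvd_prod_of_mem _ (Finset.mem_univ j)
    refine ⟨e * (q j).num, ?_⟩
    have h1 : (q j : ℝ) * ((q j).den : ℝ) = (q j).num := by exact_mod_cast Rat.mul_den_eq_num (q j)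
    rw [he]; push_cast; rw [← h1]; ring
  choose n hn using hn
  let u : DualLattice N := ∑ j, n j • c j
  have hu : ∀ s, (u s : ℝ) = d * ∑ j, (c j s : ℝ) * (q j : ℝ) := by
    intro s
    simp only [u, LinearMap.sum_apply, LinearMap.smul_apply, smul_eq_mul, Int.cast_sum,
      Int.cast_mul, hn, Finset.mul_sum]
    exact Finset.sum_congr rfl fun j _ => by ring
  have hpos : ∀ s ∈ S, 0 < f s → 0 < u s := by
    intro s hs h0
    have h1 : 0 < ∑ j, (c j s : ℝ) * (q j : ℝ) := by
      simp only [O, Set.mem_iInter, Finset.mem_filter] at hq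
      exact hq s ⟨hs, h0⟩
    have : (0 : ℝ) < u s := by rw [hu]; exact mul_pos (by exact_mod_cast hdpos) h1
    exact_mod_cast this
  have hzero : ∀ s, f s = 0 → u s = 0 := by
    intro s hs
    simp [u, hc0 s hs]
  refine ⟨u, fun s hs => ?_, fun s hs => ⟨fun h0 => ?_, fun h0 => hzero s h0⟩⟩
  · rcases (h s hs).eq_or_lt with h0 | h0
    · exact (hzero s h0.symm).ge
    · exact (hpos s hs h0).le
  · by_contra h1
    have := hpos s hs (lt_of_le_of_ne (h s hs) (Ne.symm h1))
    omega

/-- A face of a rational polyhedral cone is cut out by an element of the dual semigroup. -/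
lemma IsFace.exists_dual [Module.Finite ℤ N] {τ σ : PointedCone ℝ (RealSpan N)}
    (hσ : IsRationalPolyhedral σ) (h : IsFace τ σ) :
    ∃ u ∈ dualMonoid σ, ∀ x, x ∈ τ ↔ x ∈ σ ∧ realFunctional u x = 0 := by
  obtain ⟨S, rfl⟩ := hσ
  obtain ⟨w, hw, hτ⟩ := h
  have hwS : ∀ s ∈ S, 0 ≤ w (toReal s) := fun s hs => hw _ (toReal_mem_hull hs)
  obtain ⟨u, hu, hu0⟩ := exists_integral_functional S w hwS
  have huS : ∀ s ∈ (S : Set N), 0 ≤ realFunctional u (toReal s) := fun s hs => by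
    rw [realFunctional_toReal]; exact_mod_cast hu s hs
  refine ⟨u, mem_dualMonoid_hull.2 hu, fun x => ?_⟩
  rw [hτ]
  have hset : {s ∈ (S : Set N) | w (toReal s) = 0} =
      {s ∈ (S : Set N) | realFunctional u (toReal s) = 0} := by
    ext s
    simp only [Set.mem_ofPred_eq, and_congr_right_iff, realFunctional_toReal, Int.cast_eq_zero]
    exact fun hs => (hu0 s hs).symm
  have key : ∀ w' : RealSpan N →ₗ[ℝ] ℝ, (∀ s ∈ (S : Set N), 0 ≤ w' (toReal s)) → ∀ x,
      (x ∈ PointedCone.hull ℝ (toReal '' (S : Set N)) ∧ w' x = 0 ↔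
        x ∈ PointedCone.hull ℝ (toReal '' {s ∈ (S : Set N) | w' (toReal s) = 0})) := by
    intro w' hw' x
    refine ⟨fun hx => mem_hull_of_eq_zero hw' x hx.1 hx.2, fun hx => ⟨?_, ?_⟩⟩
    · exact Submodule.span_mono (Set.image_mono (Set.sep_subset _ _)) hx
    · apply le_antisymm
      · have := nonneg_on_hull (w := -w') (fun s hs => by
          rw [LinearMap.neg_apply, hs.2, neg_zero]) x hx
        simpa using this
      · exact nonneg_on_hull (w := w') (fun s hs => hs.2.ge) x hx
  rw [key w hwS, key (realFunctional u) huS, hset]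

lemma dualMonoid_anti {τ σ : PointedCone ℝ (RealSpan N)} (h : τ ≤ σ) :
    dualMonoid σ ≤ dualMonoid τ :=
  fun _ hu x hx => hu x (h hx)

/-- If `τ` is the face of `σ` cut out by `w`, then `τ^∨ ∩ M = σ^∨ ∩ M + ℕ (-w)`. -/
lemma exists_add_nsmul_mem {τ σ : PointedCone ℝ (RealSpan N)}
    (hσ : IsRationalPolyhedral σ) {w : DualLattice N} (hw : w ∈ dualMonoid σ)
    (hτ : ∀ x, x ∈ τ ↔ x ∈ σ ∧ realFunctional w x = 0) {u : DualLattice N}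
    (hu : u ∈ dualMonoid τ) : ∃ n : ℕ, u + n • w ∈ dualMonoid σ := by
  obtain ⟨S, rfl⟩ := hσ
  refine ⟨∑ s ∈ S, (u s).natAbs, mem_dualMonoid_hull.2 fun s hs => ?_⟩
  have hws : 0 ≤ w s := mem_dualMonoid_hull.1 hw s hs
  simp only [LinearMap.add_apply, LinearMap.smul_apply, nsmul_eq_mul]
  rcases hws.eq_or_lt with h0 | h0
  · have : toReal s ∈ τ := (hτ _).2 ⟨toReal_mem_hull hs, by rw [realFunctional_toReal, ← h0]; simp⟩
    have h1 := hu _ this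
    rw [realFunctional_toReal] at h1
    have h1 : 0 ≤ u s := by exact_mod_cast h1
    simp [← h0, h1]
  · have h1 : (u s).natAbs ≤ ∑ s ∈ S, (u s).natAbs :=
      Finset.single_le_sum (f := fun s => (u s).natAbs) (fun _ _ => Nat.zero_le _) hs
    have h2 : ((u s).natAbs : ℤ) ≤ ((∑ s ∈ S, (u s).natAbs : ℕ) : ℤ) := by exact_mod_cast h1
    have h3 : -((u s).natAbs : ℤ) ≤ u s := by omega
    nlinarith

/-- **Gordan's lemma**. -/
lemma dualMonoid_fg [Module.Finite ℤ N] [Module.Free ℤ N] {σ : PointedCone ℝ (RealSpan N)}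
    (hσ : IsRationalPolyhedral σ) : AddMonoid.FG (dualMonoid σ) := by
  obtain ⟨S, rfl⟩ := hσ
  have : AddGroup.FG (DualLattice N) := Module.Finite.iff_addGroup_fg.1 inferInstance
  have hM : AddMonoid.FG (DualLattice N) := inferInstance
  obtain ⟨n, h, hh⟩ := AddSubmonoid.fg_iff_exists_fin_addMonoidHom.1 hM.fg_top
  let ev : DualLattice N →+ (S → ℤ) :=
    { toFun := fun u s => u s, map_zero' := by ext; simp, map_add' := by intros; ext; simp }
  let f : (Fin n → ℕ) × (S → ℕ) →+ (S → ℤ) := ev.comp (h.comp (AddMonoidHom.fst _ _))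
  let g : (Fin n → ℕ) × (S → ℕ) →+ (S → ℤ) :=
    { toFun := fun p s => (p.2 s : ℤ), map_zero' := by ext; simp,
      map_add' := by intros; ext; simp }
  have hfg := AddSubmonoid.fg_eqLocusM f g
  have hmap := hfg.map (h.comp (AddMonoidHom.fst _ _))
  have heq : dualMonoid (PointedCone.hull ℝ (toReal '' (S : Set N))) =
      (f.eqLocusM g).map (h.comp (AddMonoidHom.fst _ _)) := by
    ext u
    rw [mem_dualMonoid_hull, AddSubmonoid.mem_map]
    constructor
    · intro hu
      obtain ⟨a, rfl⟩ : u ∈ AddMonoidHom.mrange h := by rw [hh]; trivial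
      refine ⟨(a, fun s => (h a s).toNat), ?_, rfl⟩
      change f _ = g _
      ext s
      simp only [f, g, ev, AddMonoidHom.coe_comp, Function.comp_apply, AddMonoidHom.coe_fst,
        AddMonoidHom.coe_mk, ZeroHom.coe_mk]
      exact (Int.toNat_of_nonneg (hu s s.2)).symm
    · rintro ⟨p, hp, rfl⟩ s hs
      have := congrFun (show f p = g p from hp) ⟨s, hs⟩
      simp only [f, g, ev, AddMonoidHom.coe_comp, Function.comp_apply, AddMonoidHom.coe_fst,
        AddMonoidHom.coe_mk, ZeroHom.coe_mk] at this
      simp only [AddMonoidHom.coe_comp, Function.comp_apply, AddMonoidHom.coe_fst]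
      omega
  rw [AddMonoid.fg_iff_addSubmonoid_fg, heq]
  exact hmap

end Cones


section Charts

variable {N : Type} [AddCommGroup N]

/-- The coordinate ring `k[σ^∨ ∩ M]` of the affine chart `U_σ`. -/
abbrev ChartRing (k : Type u) [Field k] (σ : PointedCone ℝ (RealSpan N)) : Type u :=
  AddMonoidAlgebra k (dualMonoid σ)

variable (k : Type u) [Field k]

/-- The inclusion `k[σ^∨ ∩ M] → k[τ^∨ ∩ M]` for `τ ⊆ σ`. -/
def chartMap {τ σ : PointedCone ℝ (RealSpan N)} (h : τ ≤ σ) : ChartRing k σ →ₐ[k] ChartRing k τ :=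
  AddMonoidAlgebra.mapDomainAlgHom k k (AddSubmonoid.inclusion (dualMonoid_anti h))

variable {k}

@[simp] lemma chartMap_single {τ σ : PointedCone ℝ (RealSpan N)} (h : τ ≤ σ) (u : dualMonoid σ)
    (c : k) : chartMap k h (AddMonoidAlgebra.single u c) =
      AddMonoidAlgebra.single (AddSubmonoid.inclusion (dualMonoid_anti h) u) c := by
  simp [chartMap]

lemma chartMap_injective {τ σ : PointedCone ℝ (RealSpan N)} (h : τ ≤ σ) :
    Function.Injective (chartMap k h) :=
  AddMonoidAlgebra.mapDomain_injective (AddSubmonoid.inclusion_injective _)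

instance [Module.Finite ℤ N] [Module.Free ℤ N] : UniqueSums (DualLattice N) := by
  have : AddGroup.FG (DualLattice N) := Module.Finite.iff_addGroup_fg.1 inferInstance
  have : IsAddTorsionFree (DualLattice N) :=
    Module.isTorsionFree_int_iff_isAddTorsionFree.1 inferInstance
  infer_instance

/-- The inclusion of `k[σ^∨ ∩ M]` in the group algebra `k[M]`. -/
def chartToGroupAlgebra (k : Type u) [Field k] (σ : PointedCone ℝ (RealSpan N)) :
    ChartRing k σ →ₐ[k] AddMonoidAlgebra k (DualLattice N) :=
  AddMonoidAlgebra.mapDomainAlgHom k k (dualMonoid σ).subtype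

lemma chartToGroupAlgebra_injective (σ : PointedCone ℝ (RealSpan N)) :
    Function.Injective (chartToGroupAlgebra k σ) :=
  AddMonoidAlgebra.mapDomain_injective Subtype.val_injective

instance [Module.Finite ℤ N] [Module.Free ℤ N] (σ : PointedCone ℝ (RealSpan N)) :
    IsDomain (ChartRing k σ) :=
  (chartToGroupAlgebra_injective σ).isDomain (chartToGroupAlgebra k σ).toRingHom

lemma chartRing_isNoetherian [Module.Finite ℤ N] [Module.Free ℤ N]
    {σ : PointedCone ℝ (RealSpan N)} (hσ : IsRationalPolyhedral σ) :
    IsNoetherianRing (ChartRing k σ) := by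
  have := dualMonoid_fg hσ
  exact Algebra.FiniteType.isNoetherianRing k _

/-- If `τ` is the face of `σ` cut out by `w`, then `k[τ^∨ ∩ M]` is the localization of
`k[σ^∨ ∩ M]` at the monomial `x^w`. -/
lemma chartMap_isLocalization {τ σ : PointedCone ℝ (RealSpan N)} (h : τ ≤ σ)
    (hσ : IsRationalPolyhedral σ) {w : DualLattice N} (hw : w ∈ dualMonoid σ)
    (hτ : ∀ x, x ∈ τ ↔ x ∈ σ ∧ realFunctional w x = 0) :
    letI := (chartMap k h).toRingHom.toAlgebra
    IsLocalization.Away (AddMonoidAlgebra.single (⟨w, hw⟩ : dualMonoid σ) (1 : k))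
      (ChartRing k τ) := by
  let := (chartMap k h).toRingHom.toAlgebra
  have hmap : ∀ f, algebraMap (ChartRing k σ) (ChartRing k τ) f = chartMap k h f := fun _ => rfl
  have hneg : -w ∈ dualMonoid τ := by
    intro x hx
    have := ((hτ x).1 hx).2
    simp only [realFunctional, map_neg, LinearMap.neg_apply] at this ⊢
    rw [this, neg_zero]
  refine (isLocalization_iff _ _).2 ⟨?_, ?_, ?_⟩
  · rintro ⟨_, n, rfl⟩
    simp only [map_pow]
    refine IsUnit.pow _ ?_
    refine .of_mul_eq_one (AddMonoidAlgebra.single (⟨-w, hneg⟩ : dualMonoid τ) (1 : k)) ?_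
    rw [hmap, chartMap_single, AddMonoidAlgebra.single_mul_single, AddMonoidAlgebra.one_def]
    congr 1
    · ext1; simp
    · simp
  · intro z
    suffices H : ∃ n : ℕ, ∃ f : ChartRing k σ, z * chartMap k h
        ((AddMonoidAlgebra.single (⟨w, hw⟩ : dualMonoid σ) (1 : k)) ^ n) = chartMap k h f by
      obtain ⟨n, f, hf⟩ := H
      exact ⟨(f, ⟨_, n, rfl⟩), hf⟩
    induction z using AddMonoidAlgebra.induction_linear with
    | zero => exact ⟨0, 0, by simp⟩
    | add f g hf hg =>
      obtain ⟨n, f', hf⟩ := hf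
      obtain ⟨m, g', hg⟩ := hg
      refine ⟨n + m, f' * (AddMonoidAlgebra.single (⟨w, hw⟩ : dualMonoid σ) (1 : k)) ^ m +
        g' * (AddMonoidAlgebra.single (⟨w, hw⟩ : dualMonoid σ) (1 : k)) ^ n, ?_⟩
      rw [map_add, map_mul, map_mul, ← hf, ← hg, pow_add, map_mul]
      ring
    | single u c =>
      obtain ⟨n, hn⟩ := exists_add_nsmul_mem hσ hw hτ u.2
      refine ⟨n, AddMonoidAlgebra.single ⟨_, hn⟩ c, ?_⟩
      rw [AddMonoidAlgebra.single_pow, chartMap_single, chartMap_single,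
        AddMonoidAlgebra.single_mul_single]
      congr 1
      simp
  · intro x y hxy
    exact ⟨1, by rw [chartMap_injective h hxy]⟩

/-- An integrally closed domain is integrally closed in each of its localizations. -/
lemma isIntegrallyClosedIn_of_isLocalization {R S : Type*} [CommRing R] [IsDomain R]
    [IsIntegrallyClosed R] [CommRing S] [IsDomain S] [Algebra R S] (P : Submonoid R)
    [IsLocalization P S] (hP : P ≤ nonZeroDivisors R) {x : S} (hx : IsIntegral R x) :
    ∃ y, algebraMap R S y = x := by
  let K := FractionRing R
  have hu : ∀ y : P, IsUnit (algebraMap R K y) := fun y =>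
    IsLocalization.map_units K (⟨y, hP y.2⟩ : nonZeroDivisors R)
  let g : S →+* K := IsLocalization.lift hu
  have hg : ∀ y, g (algebraMap R S y) = algebraMap R K y := IsLocalization.lift_eq hu
  have hinj : Function.Injective g := by
    refine (IsLocalization.lift_injective_iff hu).2 fun a b => ?_
    rw [(IsFractionRing.injective R K).eq_iff, (IsLocalization.injective S hP).eq_iff]
  have hgx : IsIntegral R (g x) := by
    obtain ⟨p, hp, hpx⟩ := hx
    refine ⟨p, hp, ?_⟩
    have : algebraMap R K = g.comp (algebraMap R S) := RingHom.ext fun y => (hg y).symm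
    rw [this, ← Polynomial.hom_eval₂, hpx, map_zero]
  obtain ⟨y, hy⟩ := IsIntegrallyClosed.algebraMap_eq_of_integral hgx
  exact ⟨y, hinj (by rw [hg, hy])⟩

lemma isIntegrallyClosed_groupAlgebra_fin (n : ℕ) :
    IsIntegrallyClosed (AddMonoidAlgebra k (Fin n → ℤ)) := by
  induction n with
  | zero => exact .of_equiv (AddMonoidAlgebra.uniqueRingEquiv (R := k) (Fin 0 → ℤ)).symm
  | succ n ih =>
    have h1 : IsIntegrallyClosed (LaurentPolynomial (AddMonoidAlgebra k (Fin n → ℤ))) :=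
      isIntegrallyClosed_of_isLocalization _
        (Submonoid.powers (Polynomial.X : Polynomial (AddMonoidAlgebra k (Fin n → ℤ))))
        (powers_le_nonZeroDivisors_of_noZeroDivisors Polynomial.X_ne_zero)
    exact .of_equiv ((AddMonoidAlgebra.curryRingEquiv (R := k) (M := ℤ) (N := Fin n → ℤ)).symm.trans
      (AddMonoidAlgebra.mapDomainRingEquiv k
        (Fin.consLinearEquiv ℤ (fun _ : Fin (n + 1) => ℤ)).toAddEquiv))

instance [Module.Finite ℤ N] [Module.Free ℤ N] :
    IsIntegrallyClosed (AddMonoidAlgebra k (DualLattice N)) := by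
  have := isIntegrallyClosed_groupAlgebra_fin (k := k) (Module.finrank ℤ (DualLattice N))
  exact .of_equiv (AddMonoidAlgebra.mapDomainRingEquiv k
    (Module.finBasis ℤ (DualLattice N)).equivFun.symm.toAddEquiv)

open scoped LaurentPolynomial in
/-- The ring homomorphism `x^u ↦ x^u T^⟨u, s⟩`. -/
def gradingHom (k : Type u) [Field k] (s : N) :
    AddMonoidAlgebra k (DualLattice N) →+* (AddMonoidAlgebra k (DualLattice N))[T;T⁻¹] :=
  (AddMonoidAlgebra.curryRingEquiv (R := k) (M := ℤ) (N := DualLattice N)).toRingHom.comp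
    (AddMonoidAlgebra.mapDomainRingHom k
      ({ toFun := fun u => (u s, u), map_zero' := by simp, map_add' := by simp } :
        DualLattice N →+ ℤ × DualLattice N))

lemma gradingHom_single (s : N) (u : DualLattice N) (c : k) :
    gradingHom k s (AddMonoidAlgebra.single u c) =
      AddMonoidAlgebra.single (u s) (AddMonoidAlgebra.single u c) := by
  simp [gradingHom]

lemma gradingHom_coeff (s : N) (f : AddMonoidAlgebra k (DualLattice N)) (u : DualLattice N) :
    ((gradingHom k s f).coeff (u s)).coeff u = f.coeff u := by
  classical
  induction f using AddMonoidAlgebra.induction_linear with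
  | zero => simp
  | add f g hf hg => simp [hf, hg]
  | single v c =>
    rw [gradingHom_single]
    by_cases h : v = u
    · subst h; rw [AddMonoidAlgebra.coeff_single]; simp
    · rw [AddMonoidAlgebra.coeff_single, AddMonoidAlgebra.coeff_single, Finsupp.single_apply]
      split_ifs <;> simp [h]

lemma chartRing_isIntegrallyClosed [Module.Finite ℤ N] [Module.Free ℤ N]
    {σ : PointedCone ℝ (RealSpan N)} (hσ : IsRationalPolyhedral σ) :
    IsIntegrallyClosed (ChartRing k σ) := by
  classical
  obtain ⟨S, rfl⟩ := hσ
  set σ := PointedCone.hull ℝ (toReal '' (S : Set N)) with hσ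
  let A := AddMonoidAlgebra k (DualLattice N)
  let : Algebra (ChartRing k σ) A := (chartToGroupAlgebra k σ).toRingHom.toAlgebra
  have hinj : Function.Injective (algebraMap (ChartRing k σ) A) := chartToGroupAlgebra_injective σ
  have : FaithfulSMul (ChartRing k σ) A := (faithfulSMul_iff_algebraMap_injective _ _).2 hinj
  suffices H : IsIntegrallyClosedIn (ChartRing k σ) A from
    .of_isIntegrallyClosed_of_isIntegrallyClosedIn _ A
  refine isIntegrallyClosedIn_iff.2 ⟨hinj, fun {f} hf => ?_⟩
  have hsupp : ∀ u ∈ f.coeff.support, u ∈ dualMonoid σ := by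
    intro u hu
    rw [hσ, mem_dualMonoid_hull]
    intro s hs
    by_contra hneg
    -- the image of `k[σ^∨ ∩ M]` lies in the polynomials
    have hpoly : ∀ g : ChartRing k σ, ∃ p : Polynomial A,
        algebraMap (Polynomial A) (LaurentPolynomial A) p =
          gradingHom k s (chartToGroupAlgebra k σ g) := by
      intro g
      induction g using AddMonoidAlgebra.induction_linear with
      | zero => exact ⟨0, by simp⟩
      | add g g' hg hg' =>
        obtain ⟨p, hp⟩ := hg
        obtain ⟨p', hp'⟩ := hg'
        exact ⟨p + p', by rw [map_add, map_add, map_add, hp, hp']⟩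
      | single v c =>
        have hv : 0 ≤ (v : DualLattice N) s := mem_dualMonoid_hull.1 v.2 s hs
        refine ⟨Polynomial.C (AddMonoidAlgebra.single (v : DualLattice N) c) *
          Polynomial.X ^ ((v : DualLattice N) s).toNat, ?_⟩
        have h1 : chartToGroupAlgebra k σ (AddMonoidAlgebra.single v c) =
            AddMonoidAlgebra.single (v : DualLattice N) c := by simp [chartToGroupAlgebra]
        rw [h1, gradingHom_single, LaurentPolynomial.algebraMap_eq_toLaurent,
          Polynomial.toLaurent_C_mul_X_pow, Int.toNat_of_nonneg hv,
          ← LaurentPolynomial.single_eq_C_mul_T]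
    have hint : IsIntegral (Polynomial A) (gradingHom k s f) := by
      obtain ⟨p, hp, hpf⟩ := hf
      have hinj' : Function.Injective (algebraMap (Polynomial A) (LaurentPolynomial A)) :=
        IsLocalization.injective (M := Submonoid.powers (Polynomial.X : Polynomial A)) _
          (powers_le_nonZeroDivisors_of_noZeroDivisors Polynomial.X_ne_zero)
      let R := (algebraMap (Polynomial A) (LaurentPolynomial A)).range
      let φ : ChartRing k σ →+* R :=
        ((gradingHom k s).comp (chartToGroupAlgebra k σ).toRingHom).codRestrict R
          (fun g => hpoly g)
      have h1 : IsIntegral R (gradingHom k s f) := by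
        refine ⟨p.map φ, hp.map φ, ?_⟩
        rw [Polynomial.eval₂_map]
        have : (algebraMap R (LaurentPolynomial A)).comp φ =
            (gradingHom k s).comp (algebraMap (ChartRing k σ) A) := rfl
        rw [this, ← Polynomial.hom_eval₂, hpf, map_zero]
      let e : Polynomial A ≃+* R := RingEquiv.ofBijective
        (algebraMap (Polynomial A) (LaurentPolynomial A)).rangeRestrict
        ⟨fun a b hab => hinj' (congrArg Subtype.val hab), RingHom.rangeRestrict_surjective _⟩
      obtain ⟨q, hq, hqf⟩ := h1
      refine ⟨q.map e.symm.toRingHom, hq.map _, ?_⟩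
      rw [Polynomial.eval₂_map]
      have : (algebraMap (Polynomial A) (LaurentPolynomial A)).comp e.symm.toRingHom =
          algebraMap R (LaurentPolynomial A) := by
        ext1 r
        exact congrArg Subtype.val (e.apply_symm_apply r)
      rw [this, hqf]
    obtain ⟨p, hp⟩ := isIntegrallyClosedIn_of_isLocalization
      (Submonoid.powers (Polynomial.X : Polynomial A))
      (powers_le_nonZeroDivisors_of_noZeroDivisors Polynomial.X_ne_zero) hint
    have hc := gradingHom_coeff s f u
    rw [← hp, LaurentPolynomial.algebraMap_eq_toLaurent] at hc
    have h0 : (Polynomial.toLaurent p).coeff (u s) = 0 := by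
      have : ∀ p : Polynomial A, (Polynomial.toLaurent p).coeff (u s) = 0 := by
        intro p
        induction p using Polynomial.induction_on' with
        | add p q hp hq => rw [map_add, AddMonoidAlgebra.coeff_add, Finsupp.add_apply, hp, hq, add_zero]
        | monomial n a =>
          rw [← Polynomial.C_mul_X_pow_eq_monomial, Polynomial.toLaurent_C_mul_X_pow,
            ← LaurentPolynomial.single_eq_C_mul_T, AddMonoidAlgebra.coeff_single,
            Finsupp.single_apply, if_neg (by omega)]
      exact this p
    rw [h0] at hc
    exact Finsupp.mem_support_iff.1 hu (by simpa using hc.symm)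
  refine ⟨∑ u ∈ f.coeff.support.attach,
    AddMonoidAlgebra.single (⟨u.1, hsupp u.1 u.2⟩ : dualMonoid σ) (f.coeff u.1), ?_⟩
  rw [map_sum]
  have h1 : ∀ u : f.coeff.support, algebraMap (ChartRing k σ) A
      (AddMonoidAlgebra.single (⟨u.1, hsupp u.1 u.2⟩ : dualMonoid σ) (f.coeff u.1)) =
      AddMonoidAlgebra.single u.1 (f.coeff u.1) := by
    intro u
    change chartToGroupAlgebra k σ _ = _
    simp [chartToGroupAlgebra]
  simp_rw [h1]
  rw [Finset.sum_attach _ (fun u => AddMonoidAlgebra.single u (f.coeff u))]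
  exact AddMonoidAlgebra.sum_coeff_single f

end Charts


section Scheme

variable {N : Type} [AddCommGroup N]

/-- The cones of a fan, partially ordered by inclusion (equivalently, by being a face). -/
abbrev Fan.Cone (Δ : Fan N) : Type := {σ : PointedCone ℝ (RealSpan N) // σ ∈ Δ.cones}

/-- The zero cone. -/
def Fan.zeroCone (Δ : Fan N) : Δ.Cone := ⟨⊥, Δ.bot_mem⟩

lemma Fan.isFace_of_le (Δ : Fan N) {τ σ : Δ.Cone} (h : τ ≤ σ) : IsFace τ.1 σ.1 := by
  have := (Δ.inter_face τ.1 τ.2 σ.1 σ.2).2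
  rwa [inf_eq_left.2 (show τ.1 ≤ σ.1 from h)] at this

lemma Fan.inf_mem (Δ : Fan N) (τ σ : Δ.Cone) : τ.1 ⊓ σ.1 ∈ Δ.cones :=
  Δ.face_mem _ τ.2 _ (Δ.inter_face τ.1 τ.2 σ.1 σ.2).1

lemma Fan.zeroCone_le (Δ : Fan N) (σ : Δ.Cone) : Δ.zeroCone ≤ σ :=
  show (⊥ : PointedCone ℝ (RealSpan N)) ≤ σ.1 from bot_le

variable (k : Type u) [Field k]

/-- The affine toric varieties `U_σ = Spec k[σ^∨ ∩ M]` of the cones of a fan, with the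
morphisms `U_τ ⟶ U_σ` for `τ ⊆ σ`. -/
def chartFunctor (Δ : Fan N) : Δ.Cone ⥤ Scheme.{u} where
  obj σ := Spec (.of (ChartRing k σ.1))
  map f := Spec.map (CommRingCat.ofHom (chartMap k (leOfHom f)).toRingHom)
  map_id σ := by
    rw [← Spec.map_id]
    congr 1
    ext1
    refine RingHom.ext fun x => ?_
    change chartMap k (le_refl σ.1) x = x
    induction x using AddMonoidAlgebra.induction_linear with
    | zero => simp
    | add f g hf hg => rw [map_add, hf, hg]
    | single u c => rw [chartMap_single]; rfl
  map_comp f g := by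
    rw [← Spec.map_comp]
    congr 1
    ext1
    refine RingHom.ext fun x => ?_
    change chartMap k (leOfHom (f ≫ g)) x = chartMap k (leOfHom f) (chartMap k (leOfHom g) x)
    induction x using AddMonoidAlgebra.induction_linear with
    | zero => simp
    | add f g hf hg => rw [map_add, hf, hg, map_add, map_add]
    | single u c => rw [chartMap_single, chartMap_single, chartMap_single]; rfl

variable [Module.Finite ℤ N]

lemma chartFunctor_map (Δ : Fan N) {τ σ : Δ.Cone} (f : τ ⟶ σ) :
    IsOpenImmersion ((chartFunctor k Δ).map f) ∧ ∃ (w : DualLattice N) (hw : w ∈ dualMonoid σ.1),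
      (∀ x, x ∈ τ.1 ↔ x ∈ σ.1 ∧ realFunctional w x = 0) ∧
      Set.range ((chartFunctor k Δ).map f) =
        (PrimeSpectrum.basicOpen (AddMonoidAlgebra.single (⟨w, hw⟩ : dualMonoid σ.1) (1 : k)) :
          Set (PrimeSpectrum (ChartRing k σ.1))) := by
  obtain ⟨w, hw, hτ⟩ := (Δ.isFace_of_le (leOfHom f)).exists_dual (Δ.rational _ σ.2)
  let := (chartMap k (show τ.1 ≤ σ.1 from leOfHom f)).toRingHom.toAlgebra
  have hloc := chartMap_isLocalization (k := k) (show τ.1 ≤ σ.1 from leOfHom f)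
    (Δ.rational _ σ.2) hw hτ
  refine ⟨?_, w, hw, hτ, ?_⟩
  · exact IsOpenImmersion.of_isLocalization
      (AddMonoidAlgebra.single (⟨w, hw⟩ : dualMonoid σ.1) (1 : k))
  · exact PrimeSpectrum.localization_away_comap_range (ChartRing k τ.1)
      (AddMonoidAlgebra.single (⟨w, hw⟩ : dualMonoid σ.1) (1 : k))

instance (Δ : Fan N) {τ σ : Δ.Cone} (f : τ ⟶ σ) :
    IsOpenImmersion ((chartFunctor k Δ).map f) := (chartFunctor_map k Δ f).1

instance (Δ : Fan N) : (chartFunctor k Δ ⋙ Scheme.forget).IsLocallyDirected where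
  cond {i j l} fi fj xi xj hij := by
    change (chartFunctor k Δ).map fi xi = (chartFunctor k Δ).map fj xj at hij
    let m : Δ.Cone := ⟨i.1 ⊓ j.1, Δ.inf_mem i j⟩
    let mi : m ⟶ i := homOfLE (show i.1 ⊓ j.1 ≤ i.1 from inf_le_left)
    let mj : m ⟶ j := homOfLE (show i.1 ⊓ j.1 ≤ j.1 from inf_le_right)
    obtain ⟨-, wi, hwi, hi, hri⟩ := chartFunctor_map k Δ fi
    obtain ⟨-, wj, hwj, hj, hrj⟩ := chartFunctor_map k Δ fj
    -- the point lies in the image of the chart of `i ⊓ j`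
    let x := (chartFunctor k Δ).map fi xi
    have hxi : x ∈ Set.range ((chartFunctor k Δ).map fi) := ⟨xi, rfl⟩
    have hxj : x ∈ Set.range ((chartFunctor k Δ).map fj) := ⟨xj, hij.symm⟩
    have hm : ∀ y, y ∈ m.1 ↔ y ∈ l.1 ∧ realFunctional (wi + wj) y = 0 := by
      intro y
      change y ∈ i.1 ∧ y ∈ j.1 ↔ _
      rw [hi, hj, realFunctional_add]
      constructor
      · rintro ⟨⟨h1, h2⟩, -, h3⟩; exact ⟨h1, by rw [h2, h3, add_zero]⟩
      · rintro ⟨h1, h2⟩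
        have h3 := hwi y h1
        have h4 := hwj y h1
        exact ⟨⟨h1, by linarith⟩, h1, by linarith⟩
    have hml : m.1 ≤ l.1 := fun y hy => ((hm y).1 hy).1
    have hxm : x ∈ Set.range ((chartFunctor k Δ).map (mi ≫ fi)) := by
      let := (chartMap k hml).toRingHom.toAlgebra
      have hloc := chartMap_isLocalization (k := k) hml (Δ.rational _ l.2)
        (add_mem hwi hwj) hm
      have hr : Set.range ((chartFunctor k Δ).map (mi ≫ fi)) =
          (PrimeSpectrum.basicOpen (AddMonoidAlgebra.single
            (⟨wi + wj, add_mem hwi hwj⟩ : dualMonoid l.1) (1 : k)) :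
          Set (PrimeSpectrum (ChartRing k l.1))) :=
        PrimeSpectrum.localization_away_comap_range (ChartRing k m.1) _
      have hs : (AddMonoidAlgebra.single (⟨wi + wj, add_mem hwi hwj⟩ : dualMonoid l.1) (1 : k)) =
          AddMonoidAlgebra.single (⟨wi, hwi⟩ : dualMonoid l.1) (1 : k) *
            AddMonoidAlgebra.single (⟨wj, hwj⟩ : dualMonoid l.1) (1 : k) := by
        rw [AddMonoidAlgebra.single_mul_single, one_mul]; rfl
      rw [hr, hs, PrimeSpectrum.basicOpen_mul]
      rw [hri] at hxi
      rw [hrj] at hxj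
      exact ⟨hxi, hxj⟩
    obtain ⟨y, hy⟩ := hxm
    refine ⟨m, mi, mj, y, ?_, ?_⟩
    · apply ((chartFunctor k Δ).map fi).isOpenEmbedding.injective
      change (chartFunctor k Δ).map fi ((chartFunctor k Δ).map mi y) = _
      rw [← Scheme.Hom.comp_apply, ← Functor.map_comp, hy]
    · apply ((chartFunctor k Δ).map fj).isOpenEmbedding.injective
      change (chartFunctor k Δ).map fj ((chartFunctor k Δ).map mj y) = _
      rw [← Scheme.Hom.comp_apply, ← Functor.map_comp, ← hij,
        show mj ≫ fj = mi ≫ fi from Subsingleton.elim _ _, hy]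

/-- The toric variety `X(Δ)`, glued from the affine charts `U_σ`, `σ ∈ Δ`, along the open
subschemes `U_{σ ∩ τ}`. -/
def toricVariety (Δ : Fan N) : Scheme.{u} := colimit (chartFunctor k Δ)

/-- The open immersion `U_σ ⟶ X(Δ)`. -/
def chartι {Δ : Fan N} (σ : Δ.Cone) : Spec (.of (ChartRing k σ.1)) ⟶ toricVariety k Δ :=
  colimit.ι (chartFunctor k Δ) σ

instance {Δ : Fan N} (σ : Δ.Cone) : IsOpenImmersion (chartι k σ) :=
  inferInstanceAs (IsOpenImmersion (colimit.ι (chartFunctor k Δ) σ))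

/-- The cover of `X(Δ)` by the charts `U_σ`. -/
def chartCover (Δ : Fan N) : (toricVariety k Δ).OpenCover :=
  Scheme.IsLocallyDirected.openCover (chartFunctor k Δ)

lemma exists_chartι_eq {Δ : Fan N} (x : toricVariety k Δ) :
    ∃ (σ : Δ.Cone) (y : Spec (.of (ChartRing k σ.1))), chartι k σ y = x :=
  Scheme.IsLocallyDirected.ι_jointly_surjective (chartFunctor k Δ) x

lemma chartFunctor_map_chartι {Δ : Fan N} {τ σ : Δ.Cone} (f : τ ⟶ σ) :
    (chartFunctor k Δ).map f ≫ chartι k σ = chartι k τ :=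
  colimit.w (chartFunctor k Δ) f

variable [Module.Free ℤ N]

instance (Δ : Fan N) : IsLocallyNoetherian (toricVariety k Δ) := by
  rw [isLocallyNoetherian_iff_openCover (chartCover k Δ)]
  intro σ
  have := chartRing_isNoetherian (k := k) (Δ.rational _ σ.2)
  exact inferInstanceAs (IsLocallyNoetherian (Spec (.of (ChartRing k σ.1))))

instance (Δ : Fan N) : IrreducibleSpace (toricVariety k Δ) := by
  have h0 : IsIrreducible (Set.range (chartι k Δ.zeroCone)) := by
    rw [← Set.image_univ]
    exact (IrreducibleSpace.isIrreducible_univ _).image _ (chartι k _).continuous.continuousOn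
  have hcl : closure (Set.range (chartι k Δ.zeroCone)) = Set.univ := by
    refine Set.eq_univ_of_forall fun x => ?_
    obtain ⟨σ, y, rfl⟩ := exists_chartι_eq k x
    let f : Δ.zeroCone ⟶ σ := homOfLE (Δ.zeroCone_le σ)
    let g : Spec (.of (ChartRing k Δ.zeroCone.1)) ⟶ Spec (.of (ChartRing k σ.1)) :=
      (chartFunctor k Δ).map f
    have hg : IsOpenImmersion g := (chartFunctor_map k Δ f).1
    have hd : Dense (Set.range g) :=
      g.isOpenEmbedding.isOpen_range.dense (Set.range_nonempty _)
    have hy : chartι k σ y ∈ chartι k σ '' closure (Set.range g) := ⟨y, hd y, rfl⟩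
    refine closure_mono ?_ (image_closure_subset_closure_image (chartι k σ).continuous hy)
    rintro _ ⟨_, ⟨z, rfl⟩, rfl⟩
    exact ⟨z, by rw [← Scheme.Hom.comp_apply, ← chartFunctor_map_chartι k f]; rfl⟩
  have := h0.closure
  rw [hcl] at this
  exact (irreducibleSpace_def _).2 this

instance (Δ : Fan N) : AlgebraicGeometry.IsReduced (toricVariety k Δ) := by
  have : ∀ σ : (chartCover k Δ).I₀, AlgebraicGeometry.IsReduced ((chartCover k Δ).X σ) := fun σ =>
    inferInstanceAs (AlgebraicGeometry.IsReduced (Spec (.of (ChartRing k (σ : Δ.Cone).1))))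
  exact AlgebraicGeometry.IsReduced.of_openCover _ (chartCover k Δ)

instance (Δ : Fan N) : AlgebraicGeometry.IsIntegral (toricVariety k Δ) :=
  isIntegral_of_irreducibleSpace_of_isReduced _

lemma isIntegrallyClosed_stalk_structureSheaf (R : Type u) [CommRing R] [IsDomain R]
    [IsIntegrallyClosed R] (y : PrimeSpectrum R) :
    IsIntegrallyClosed ((Spec.structureSheaf R).presheaf.stalk y) :=
  isIntegrallyClosed_of_isLocalization _ y.asIdeal.primeCompl
    (Ideal.primeCompl_le_nonZeroDivisors _)

/-- The toric variety `X(Δ)` is normal. -/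
instance (Δ : Fan N) (x : toricVariety k Δ) :
    IsIntegrallyClosed ((toricVariety k Δ).presheaf.stalk x) := by
  obtain ⟨σ, y, rfl⟩ := exists_chartι_eq k x
  have h1 := chartRing_isIntegrallyClosed (k := k) (Δ.rational _ σ.2)
  have h2 : IsIntegrallyClosed ((Spec (.of (ChartRing k σ.1))).presheaf.stalk y) :=
    isIntegrallyClosed_stalk_structureSheaf (ChartRing k σ.1) y
  exact .of_equiv (asIso ((chartι k σ).stalkMap y)).symm.commRingCatIsoToRingEquiv

end Scheme


section WeilDivisors

variable (X : Scheme.{u})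

/-- A prime divisor of `X`, given by its generic point, a point of codimension one. -/
abbrev PrimeDivisor : Type u := {z : X // Order.coheight z = 1}

/-- The group of Weil divisors. -/
abbrev WeilDivisor : Type u := PrimeDivisor X →₀ ℤ

variable [AlgebraicGeometry.IsIntegral X] [IsLocallyNoetherian X]

/-- The subgroup of principal divisors `div(f)`, for `f` a nonzero rational function. -/
def principalDivisors : AddSubgroup (WeilDivisor X) where
  carrier := {D | ∃ f : X.functionField, f ≠ 0 ∧ ∀ z : PrimeDivisor X, D z = X.ord f z.1}
  zero_mem' := ⟨1, one_ne_zero, fun z => by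
    have := Scheme.ord_mul (X := X) (x := z.1) (one_ne_zero (α := X.functionField)) one_ne_zero
    rw [mul_one] at this
    simp only [Finsupp.coe_zero, Pi.zero_apply]
    omega⟩
  add_mem' := by
    rintro D E ⟨f, hf, hD⟩ ⟨g, hg, hE⟩
    exact ⟨f * g, mul_ne_zero hf hg, fun z => by
      rw [Finsupp.add_apply, hD, hE, Scheme.ord_mul hf hg]⟩
  neg_mem' := by
    rintro D ⟨f, hf, hD⟩
    refine ⟨f⁻¹, inv_ne_zero hf, fun z => ?_⟩
    have h1 := Scheme.ord_mul (X := X) (x := z.1) (one_ne_zero (α := X.functionField)) one_ne_zero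
    have h2 := Scheme.ord_mul (X := X) (x := z.1) hf (inv_ne_zero hf)
    rw [mul_one] at h1
    rw [mul_inv_cancel₀ hf] at h2
    rw [Finsupp.neg_apply, hD]
    omega

/-- The divisor class group `Cl(X)`: Weil divisors modulo principal divisors. -/
abbrev DivisorClassGroup : Type u := WeilDivisor X ⧸ principalDivisors X

variable {X}

lemma isDiscreteValuationRing_stalk (z : PrimeDivisor X)
    [IsIntegrallyClosed (X.presheaf.stalk z.1)] :
    IsDiscreteValuationRing (X.presheaf.stalk z.1) := by
  have hdim : Ring.KrullDimLE 1 (X.presheaf.stalk z.1) := krullDimLE_of_coheight_le z.2.le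
  have hnf : ¬ IsField (X.presheaf.stalk z.1) := by
    intro h
    have h1 := ringKrullDim_stalk_eq_coheight z.1
    rw [ringKrullDim_eq_zero_of_isField h, z.2] at h1
    exact absurd h1 (by decide)
  have h1 : Ring.DimensionLEOne (X.presheaf.stalk z.1) :=
    ⟨fun hp hP => (Ring.krullDimLE_one_iff_of_noZeroDivisors.1 hdim) _ hp hP⟩
  have h2 : IsDedekindDomain (X.presheaf.stalk z.1) := {}
  exact ((IsDiscreteValuationRing.TFAE _ hnf).out 2 0).1 h2

/-- The sections of the sheaf `𝒪(D)` over a nonempty open `U`: the rational functions `f` with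
`f = 0` or `div(f) + D ≥ 0` on `U`. -/
def sectionsOn [∀ x : X, IsIntegrallyClosed (X.presheaf.stalk x)] (D : WeilDivisor X)
    (U : X.Opens) : AddSubgroup X.functionField where
  carrier := {f | f = 0 ∨ ∀ z : PrimeDivisor X, z.1 ∈ U → 0 ≤ X.ord f z.1 + D z}
  zero_mem' := Or.inl rfl
  add_mem' := by
    rintro f g (rfl | hf) (rfl | hg)
    · left; simp
    · right; simpa using hg
    · right; simpa using hf
    · by_cases h : f + g = 0
      · exact Or.inl h
      · refine Or.inr fun z hz => ?_
        have := isDiscreteValuationRing_stalk z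
        have h1 := Scheme.ord_add (x := z.1) h
        have h2 := hf z hz
        have h3 := hg z hz
        rcases min_le_iff.1 h1 with h4 | h4 <;> omega
  neg_mem' := by
    rintro f (rfl | hf)
    · left; simp
    · by_cases h0 : f = 0
      · left; simp [h0]
      refine Or.inr fun z hz => ?_
      have h1 := Scheme.ord_mul (X := X) (x := z.1) (one_ne_zero (α := X.functionField)) one_ne_zero
      have hn : (-1 : X.functionField) ≠ 0 := neg_ne_zero.2 one_ne_zero
      have h2 := Scheme.ord_mul (X := X) (x := z.1) hn hn
      have h3 := Scheme.ord_mul (X := X) (x := z.1) hn h0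
      rw [mul_one] at h1
      rw [neg_mul_neg, mul_one] at h2
      rw [neg_one_mul] at h3
      have h4 := hf z hz
      omega

end WeilDivisors

section Toric

variable (k : Type u) [Field k] {N : Type} [AddCommGroup N]

lemma mem_dualMonoid_bot (u : DualLattice N) :
    u ∈ dualMonoid (⊥ : PointedCone ℝ (RealSpan N)) := by
  intro x hx
  rw [(Submodule.mem_bot _).1 hx, map_zero]

/-- The points `t ∈ T(k) = Hom(M, k^*)` of the torus. -/
abbrev TorusPoint (k : Type u) [Field k] (N : Type) [AddCommGroup N] : Type u :=
  Multiplicative (DualLattice N) →* kˣ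

variable {k} in
/-- The action of `t ∈ T(k)` on `k[σ^∨ ∩ M]`, `x^u ↦ t(u) x^u`. -/
def chartAction (t : TorusPoint k N) (σ : PointedCone ℝ (RealSpan N)) :
    ChartRing k σ →ₐ[k] ChartRing k σ :=
  AddMonoidAlgebra.lift k (ChartRing k σ) (dualMonoid σ)
    { toFun := fun u => AddMonoidAlgebra.single u.toAdd
        (t (Multiplicative.ofAdd (u.toAdd : DualLattice N)) : k)
      map_one' := by
        rw [AddMonoidAlgebra.one_def]
        simp
      map_mul' := fun a b => by
        rw [AddMonoidAlgebra.single_mul_single]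
        simp }

variable {k} in
lemma chartAction_single (t : TorusPoint k N) (σ : PointedCone ℝ (RealSpan N))
    (u : dualMonoid σ) (c : k) :
    chartAction t σ (AddMonoidAlgebra.single u c) =
      AddMonoidAlgebra.single u (c * t (Multiplicative.ofAdd (u : DualLattice N))) := by
  simp [chartAction]

variable [Module.Finite ℤ N]

/-- The structure morphism `X(Δ) ⟶ Spec k`. -/
def structureMorphism (Δ : Fan N) : toricVariety k Δ ⟶ Spec (.of k) :=
  colimit.desc (chartFunctor k Δ)
    { pt := Spec (.of k)
      ι :=
        { app := fun σ => Spec.map (CommRingCat.ofHom (algebraMap k (ChartRing k σ.1)))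
          naturality := fun τ σ f => by
            change Spec.map (CommRingCat.ofHom (chartMap k (leOfHom f)).toRingHom) ≫ _ = _ ≫ 𝟙 _
            rw [Category.comp_id, ← Spec.map_comp, ← CommRingCat.ofHom_comp]
            congr 2
            exact (chartMap k (leOfHom f)).comp_algebraMap } }

/-- The constants `k → Γ(X(Δ), 𝒪)`. -/
def constants (Δ : Fan N) : k →+* Γ(toricVariety k Δ, ⊤) :=
  ((Scheme.ΓSpecIso (.of k)).inv ≫ (structureMorphism k Δ).appTop).hom

variable {k}

/-- The action of `t ∈ T(k)` on `X(Δ)`. -/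
def torusAction {Δ : Fan N} (t : TorusPoint k N) : toricVariety k Δ ⟶ toricVariety k Δ :=
  colimMap
    { app := fun σ => Spec.map (CommRingCat.ofHom (chartAction t σ.1).toRingHom)
      naturality := fun τ σ f => by
        change Spec.map (CommRingCat.ofHom (chartMap k (leOfHom f)).toRingHom) ≫ _ =
          _ ≫ Spec.map (CommRingCat.ofHom (chartMap k (leOfHom f)).toRingHom)
        rw [← Spec.map_comp, ← Spec.map_comp, ← CommRingCat.ofHom_comp, ← CommRingCat.ofHom_comp]
        congr 2
        refine RingHom.ext fun x => ?_
        change chartMap k (leOfHom f) (chartAction t _ x) =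
          chartAction t _ (chartMap k (leOfHom f) x)
        induction x using AddMonoidAlgebra.induction_linear with
        | zero => simp
        | add f g hf hg => simp only [map_add, hf, hg]
        | single u c => simp only [chartAction_single, chartMap_single]; rfl }

/-- A Weil divisor on `X(Δ)` is torus-invariant if its coefficients are constant along the orbits of
the torus on the set of prime divisors. -/
def IsTorusInvariant {Δ : Fan N} (D : WeilDivisor (toricVariety k Δ)) : Prop :=
  ∀ (t : TorusPoint k N) (Y Z : PrimeDivisor (toricVariety k Δ)),
    torusAction t Y.1 = Z.1 → D Z = D Y

variable [Module.Free ℤ N]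

instance (Δ : Fan N) : Nonempty (⊤ : (toricVariety k Δ).Opens) :=
  ⟨⟨genericPoint _, trivial⟩⟩

/-- The function field `k(X)` is an extension of `k`. -/
instance (Δ : Fan N) : Algebra k (toricVariety k Δ).functionField :=
  (((toricVariety k Δ).germToFunctionField ⊤).hom.comp (constants k Δ)).toAlgebra

/-- The space `H⁰(X(Δ), 𝒪(D))` of global sections of the sheaf `𝒪(D)`. -/
def globalSections {Δ : Fan N} (D : WeilDivisor (toricVariety k Δ)) :
    Submodule k (toricVariety k Δ).functionField where
  __ := (sectionsOn D ⊤).toAddSubmonoid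
  smul_mem' := by
    rintro c f (rfl | hf)
    · exact Or.inl (smul_zero c)
    · by_cases h : c = 0 ∨ f = 0
      · left
        rcases h with h | h <;> simp [h]
      push Not at h
      refine Or.inr fun z hz => ?_
      have hu : IsUnit (constants k Δ c) := (IsUnit.mk0 c h.1).map _
      have h1 : c • f = (toricVariety k Δ).germToFunctionField ⊤ (constants k Δ c) * f := by
        rw [Algebra.smul_def]; rfl
      have h2 : (toricVariety k Δ).germToFunctionField ⊤ (constants k Δ c) ≠ 0 :=
        (hu.map ((toricVariety k Δ).germToFunctionField ⊤).hom).ne_zero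
      rw [h1, Scheme.ord_mul h2 h.2, Scheme.ord_of_isUnit hu (x := z.1) trivial, zero_add]
      exact hf z hz

lemma mem_globalSections {Δ : Fan N} {D : WeilDivisor (toricVariety k Δ)}
    {f : (toricVariety k Δ).functionField} :
    f ∈ globalSections D ↔ f = 0 ∨ ∀ z, 0 ≤ (toricVariety k Δ).ord f z.1 + D z := by
  change (f = 0 ∨ ∀ z : PrimeDivisor (toricVariety k Δ),
    z.1 ∈ (⊤ : (toricVariety k Δ).Opens) → _) ↔ _
  simp

variable (k) in
/-- The inclusion `k[M] → k(X)` of the coordinate ring of the torus `U_0` in the function field. -/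
def torusToFunctionField (Δ : Fan N) :
    ChartRing k Δ.zeroCone.1 →+* (toricVariety k Δ).functionField :=
  haveI : Nonempty (chartι k Δ.zeroCone ''ᵁ ⊤) :=
    ⟨⟨chartι k Δ.zeroCone (genericPoint _), ⟨_, trivial, rfl⟩⟩⟩
  ((Scheme.ΓSpecIso (.of (ChartRing k Δ.zeroCone.1))).inv ≫
    ((chartι k Δ.zeroCone).appIso ⊤).inv ≫
    (toricVariety k Δ).germToFunctionField (chartι k Δ.zeroCone ''ᵁ ⊤)).hom

variable (k) in
/-- The character `x^u`, `u ∈ M`, as a rational function on `X(Δ)`. -/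
def character (Δ : Fan N) (u : DualLattice N) : (toricVariety k Δ).functionField :=
  torusToFunctionField k Δ (AddMonoidAlgebra.single ⟨u, mem_dualMonoid_bot u⟩ 1)

end Toric

section Rays

variable {N : Type} [AddCommGroup N]

/-- A lattice vector is primitive if it is not a proper multiple of a lattice vector. -/
def IsPrimitive (v : N) : Prop := ∀ (n : ℤ) (w : N), v = n • w → IsUnit n

/-- The ray `ℝ_{≥0} v`. -/
def rayCone (v : N) : PointedCone ℝ (RealSpan N) := PointedCone.hull ℝ (toReal '' {v})

/-- The set `Δ(1)` of rays of the fan. A ray is represented by its primitive generator. -/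
@[ext] structure Fan.Ray (Δ : Fan N) where
  gen : N
  isPrimitive : IsPrimitive gen
  mem : rayCone gen ∈ Δ.cones

/-- The ray as a cone of the fan. -/
def Fan.Ray.cone {Δ : Fan N} (ρ : Δ.Ray) : Δ.Cone := ⟨rayCone ρ.gen, ρ.mem⟩

lemma IsPrimitive.exists_eq_one [Module.Finite ℤ N] [Module.Free ℤ N] {v : N}
    (hv : IsPrimitive v) : ∃ m : DualLattice N, m v = 1 := by
  let b := Module.finBasis ℤ N
  let ev : DualLattice N →ₗ[ℤ] ℤ := LinearMap.applyₗ v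
  obtain ⟨d, hd⟩ := (IsPrincipalIdealRing.principal (LinearMap.range ev : Ideal ℤ)).principal
  have hdvd : ∀ m : DualLattice N, d ∣ m v := by
    intro m
    have : m v ∈ (LinearMap.range ev : Ideal ℤ) := ⟨m, rfl⟩
    rw [hd] at this
    exact Ideal.mem_span_singleton.1 this
  choose c hc using fun i => hdvd (b.coord i)
  have hunit : IsUnit d := by
    refine hv d (∑ i, c i • b i) ?_
    rw [Finset.smul_sum, ← b.sum_repr v]
    refine Finset.sum_congr rfl fun i _ => ?_
    have := hc i
    simp only [Module.Basis.coord_apply] at this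
    rw [this, smul_smul]
  have h1 : (1 : ℤ) ∈ (LinearMap.range ev : Ideal ℤ) := by
    rw [hd]
    exact Ideal.mem_span_singleton.2 hunit.dvd
  exact h1

lemma mem_dualMonoid_rayCone {v : N} {u : DualLattice N} :
    u ∈ dualMonoid (rayCone v) ↔ 0 ≤ u v := by
  rw [rayCone, mem_dualMonoid_hull]; simp

lemma rayCone_injOn [Module.Finite ℤ N] [Module.Free ℤ N] {v w : N} (hv : IsPrimitive v)
    (hw : IsPrimitive w) (h : rayCone v = rayCone w) : v = w := by
  -- a functional is nonnegative on `v` iff it is on `w`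
  have key : ∀ u : DualLattice N, 0 ≤ u v ↔ 0 ≤ u w := fun u => by
    rw [← mem_dualMonoid_rayCone, h, mem_dualMonoid_rayCone]
  have key0 : ∀ u : DualLattice N, u v = 0 → u w = 0 := fun u hu => by
    have h1 := (key u).1 hu.ge
    have h2 := (key (-u)).1 (by simp [hu])
    simp only [LinearMap.neg_apply] at h2
    omega
  obtain ⟨m, hm⟩ := hv.exists_eq_one
  have hall : ∀ u : DualLattice N, u w = u v * m w := fun u => by
    have := key0 (u - u v • m) (by simp [hm])
    simp only [LinearMap.sub_apply, LinearMap.smul_apply, smul_eq_mul] at this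
    omega
  obtain ⟨m', hm'⟩ := hw.exists_eq_one
  have h1 := hall m'
  rw [hm'] at h1
  have h2 : 0 ≤ m w := (key m).1 (by omega)
  have h3 : m w = 1 := Int.eq_one_of_mul_eq_one_left h2 h1.symm
  refine (Module.finBasis ℤ N).ext_elem fun i => ?_
  have := hall ((Module.finBasis ℤ N).coord i)
  rw [h3, mul_one] at this
  exact this.symm

instance [Module.Finite ℤ N] [Module.Free ℤ N] (Δ : Fan N) : Finite Δ.Ray := by
  have := Δ.finite.to_subtype
  refine Finite.of_injective (fun ρ : Δ.Ray => ρ.cone) fun ρ ρ' h => ?_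
  exact Fan.Ray.ext (rayCone_injOn ρ.isPrimitive ρ'.isPrimitive (congrArg Subtype.val h))

instance [Module.Finite ℤ N] [Module.Free ℤ N] (Δ : Fan N) : Fintype Δ.Ray := Fintype.ofFinite _

variable (k : Type u) [Field k]

/-- The ideal of `Y(v)` in the chart `U_ρ` of the ray `ρ = ℝ_{≥0} v`: it is generated by the `x^u`
with `⟨u, v⟩ > 0`. -/
def rayIdeal (v : N) : Ideal (ChartRing k (rayCone v)) :=
  Ideal.span {f | ∃ u : dualMonoid (rayCone v), 0 < (u : DualLattice N) v ∧
    f = AddMonoidAlgebra.single u 1}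

variable {k}

lemma rayIdeal_eq_span {v : N} {m : dualMonoid (rayCone v)} (hm : (m : DualLattice N) v = 1) :
    rayIdeal k v = Ideal.span {AddMonoidAlgebra.single m 1} := by
  apply le_antisymm
  · refine Ideal.span_le.2 ?_
    rintro _ ⟨u, hu, rfl⟩
    refine Ideal.mem_span_singleton'.2 ⟨AddMonoidAlgebra.single
      (⟨u - m, mem_dualMonoid_rayCone.2 (by rw [LinearMap.sub_apply, hm]; omega)⟩ :
        dualMonoid (rayCone v)) 1, ?_⟩
    rw [AddMonoidAlgebra.single_mul_single, one_mul]
    congr 1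
    ext1
    simp
  · refine Ideal.span_mono ?_
    rintro _ rfl
    exact ⟨m, by omega, rfl⟩

lemma mem_rayIdeal_iff {v : N} {f : ChartRing k (rayCone v)} :
    f ∈ rayIdeal k v ↔ ∀ u : dualMonoid (rayCone v), (u : DualLattice N) v = 0 → f.coeff u = 0 := by
  classical
  constructor
  · intro hf
    refine Submodule.span_induction ?_ ?_ ?_ ?_ hf
    · rintro _ ⟨w, hw, rfl⟩ u hu
      rw [AddMonoidAlgebra.coeff_single, Finsupp.single_apply, if_neg]
      rintro rfl
      omega
    · intro u _; simp
    · intro a b _ _ ha hb u hu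
      simp [ha u hu, hb u hu]
    · intro a b _ hb u hu
      rw [smul_eq_mul]
      induction a using AddMonoidAlgebra.induction_linear with
      | zero => simp
      | add a a' h h' => rw [add_mul, AddMonoidAlgebra.coeff_add, Finsupp.add_apply, h, h', add_zero]
      | single w c =>
        rw [AddMonoidAlgebra.coeff_mul, AddMonoidAlgebra.coeff_single, Finsupp.sum_single_index (by simp)]
        refine Finset.sum_eq_zero fun w' _ => ?_
        dsimp only
        split_ifs with h
        · have h1 : 0 ≤ (w : DualLattice N) v := mem_dualMonoid_rayCone.1 w.2
          have h2 : 0 ≤ (w' : DualLattice N) v := mem_dualMonoid_rayCone.1 w'.2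
          have h3 : (w : DualLattice N) v + (w' : DualLattice N) v = 0 := by
            rw [← hu, ← h]; simp
          rw [hb w' (by omega), mul_zero]
        · rfl
  · intro hf
    rw [← AddMonoidAlgebra.sum_coeff_single f]
    refine Ideal.sum_mem _ fun u hu => ?_
    have h1 : 0 ≤ (u : DualLattice N) v := mem_dualMonoid_rayCone.1 u.2
    have h2 : (u : DualLattice N) v ≠ 0 := fun h => Finsupp.mem_support_iff.1 hu (hf u h)
    have h3 : AddMonoidAlgebra.single u (f.coeff u) =
        AddMonoidAlgebra.single 0 (f.coeff u) * AddMonoidAlgebra.single u (1 : k) := by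
      rw [AddMonoidAlgebra.single_mul_single, zero_add, mul_one]
    change AddMonoidAlgebra.single u (f.coeff u) ∈ _
    rw [h3]
    exact Ideal.mul_mem_left _ _ (Ideal.subset_span ⟨u, by omega, rfl⟩)

/-- The restriction `k[ρ^∨ ∩ M] → k[M]`, `x^u ↦ x^u` if `⟨u, v⟩ = 0` and `x^u ↦ 0` otherwise. -/
def rayRestriction (k : Type u) [Field k] (v : N) :
    ChartRing k (rayCone v) →ₐ[k] AddMonoidAlgebra k (DualLattice N) :=
  open scoped Classical in
  AddMonoidAlgebra.lift k _ (dualMonoid (rayCone v))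
    { toFun := fun u => if (u.toAdd : DualLattice N) v = 0 then
        AddMonoidAlgebra.single (u.toAdd : DualLattice N) 1 else 0
      map_one' := by simp [AddMonoidAlgebra.one_def]
      map_mul' := fun a b => by
        have h1 : 0 ≤ (a.toAdd : DualLattice N) v := mem_dualMonoid_rayCone.1 a.toAdd.2
        have h2 : 0 ≤ (b.toAdd : DualLattice N) v := mem_dualMonoid_rayCone.1 b.toAdd.2
        simp only [toAdd_mul, AddSubmonoid.coe_add, LinearMap.add_apply]
        by_cases ha : (a.toAdd : DualLattice N) v = 0
        · by_cases hb : (b.toAdd : DualLattice N) v = 0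
          · simp [ha, hb, AddMonoidAlgebra.single_mul_single]
          · simp [ha, hb]
        · rw [if_neg (by omega), if_neg ha, zero_mul] }

lemma rayRestriction_coeff (v : N) (f : ChartRing k (rayCone v)) (u : dualMonoid (rayCone v)) :
    (rayRestriction k v f).coeff (u : DualLattice N) =
      open scoped Classical in if (u : DualLattice N) v = 0 then f.coeff u else 0 := by
  classical
  induction f using AddMonoidAlgebra.induction_linear with
  | zero => simp
  | add f g hf hg =>
    rw [map_add, AddMonoidAlgebra.coeff_add, AddMonoidAlgebra.coeff_add, Finsupp.add_apply, hf, hg,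
      Finsupp.add_apply]
    split_ifs <;> simp
  | single w c =>
    rw [rayRestriction, AddMonoidAlgebra.lift_single]
    simp only [MonoidHom.coe_mk, OneHom.coe_mk, toAdd_ofAdd, smul_ite, smul_zero,
      AddMonoidAlgebra.smul_single, smul_eq_mul, mul_one]
    by_cases h : w = u
    · subst h; split_ifs <;> simp
    · have h' : (w : DualLattice N) ≠ u := fun h' => h (Subtype.ext h')
      split_ifs <;> simp [h, h']

variable [Module.Finite ℤ N] [Module.Free ℤ N]

lemma rayIdeal_isPrime (v : N) : (rayIdeal k v).IsPrime := by
  classical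
  have : rayIdeal k v = RingHom.ker (rayRestriction k v).toRingHom := by
    ext f
    rw [mem_rayIdeal_iff, RingHom.mem_ker]
    change _ ↔ rayRestriction k v f = 0
    constructor
    · intro hf
      have : f ∈ rayIdeal k v := mem_rayIdeal_iff.2 hf
      refine Submodule.span_induction ?_ ?_ ?_ ?_ this
      · rintro _ ⟨w, hw, rfl⟩
        rw [rayRestriction, AddMonoidAlgebra.lift_single]
        simp [hw.ne']
      · simp
      · intro a b _ _ ha hb; rw [map_add, ha, hb, add_zero]
      · intro a b _ hb; rw [smul_eq_mul, map_mul, hb, mul_zero]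
    · intro hf u hu
      have := rayRestriction_coeff v f u
      rw [hf, if_pos hu] at this
      simpa using this.symm
  rw [this]
  exact RingHom.ker_isPrime _

lemma rayIdeal_height {v : N} (hv : IsPrimitive v) : (rayIdeal k v).height = 1 := by
  obtain ⟨m, hm⟩ := hv.exists_eq_one
  let m' : dualMonoid (rayCone v) := ⟨m, mem_dualMonoid_rayCone.2 (by omega)⟩
  have : IsNoetherianRing (ChartRing k (rayCone v)) :=
    chartRing_isNoetherian ⟨{v}, by simp [rayCone]⟩
  have hsp := rayIdeal_eq_span (k := k) (m := m') hm
  have hp := rayIdeal_isPrime (k := k) v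
  rw [hsp] at hp ⊢
  refine Ideal.height_span_singleton_eq_one_of_mem_nonZeroDivisors ?_ ?_
  · exact mem_nonZeroDivisors_of_ne_zero fun h => by
      simpa using congrArg (fun f => f.coeff m') h
  · exact fun h => hp.ne_top (Ideal.span_singleton_eq_top.2 h)

/-- The generic point of `Y(v)` in the chart `U_ρ`. -/
def rayPoint (v : N) : Spec (.of (ChartRing k (rayCone v))) :=
  (⟨rayIdeal k v, rayIdeal_isPrime v⟩ : PrimeSpectrum (ChartRing k (rayCone v)))

variable (k) in
/-- The torus-invariant prime divisor `Y(v)` of a ray `v ∈ Δ(1)`. -/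
def rayDivisor {Δ : Fan N} (ρ : Δ.Ray) : PrimeDivisor (toricVariety k Δ) :=
  ⟨chartι k ρ.cone (rayPoint ρ.gen), by
    refine (coheight_eq_of_isOpenImmersion (chartι k ρ.cone)).trans ?_
    have h2 := idealHeight_eq_coheight (.of (ChartRing k (rayCone ρ.gen))) (rayPoint ρ.gen)
    exact h2.symm.trans (rayIdeal_height ρ.isPrimitive)⟩

variable (k) in
/-- The Cox ring of `X(Δ)`: the polynomial ring with one variable for each ray. -/
abbrev CoxRing (Δ : Fan N) : Type u := MvPolynomial Δ.Ray k

variable (k) in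
/-- The degree `[Y(v)] ∈ Cl(X)` of the variable `v`. -/
def coxDegree {Δ : Fan N} (ρ : Δ.Ray) : DivisorClassGroup (toricVariety k Δ) :=
  QuotientAddGroup.mk (Finsupp.single (rayDivisor k ρ) 1)

/-- The graded piece of the Cox ring of degree `c ∈ Cl(X)`. -/
def coxGradedPiece {Δ : Fan N} (c : DivisorClassGroup (toricVariety k Δ)) :
    Submodule k (CoxRing k Δ) :=
  MvPolynomial.weightedHomogeneousSubmodule k (coxDegree k) c

end Rays

end Toric

end

noncomputable section
namespace Toric
open CategoryTheory CategoryTheory.Limits AlgebraicGeometry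
open scoped TensorProduct
universe u

/-! ### Cones of a fan are generated by their rays -/

section RayGenerators

/-! Both spaces have a basis indexed by the same set, the lattice points `u` with `⟨u, v_i⟩ + a_i ≥
0` for all `i` (`polyhedronPoints`): on one side the characters `x^u`, on the other the monomials
with exponents `⟨u, v_i⟩ + a_i`. The isomorphism matches the two bases, and it is unique because its
values on a basis are prescribed.

Geometry of the prime divisors. Those whose generic point lies outside the torus are the `Y(v_i)`
(`exists_rayDivisor_eq`), and `x^u` has order `⟨u, v_i⟩` along `Y(v_i)` (`ord_character_rayDivisor`)
and order `0` along the divisors that meet the torus. A torus-invariant `D` has no component that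
meets the torus: over an infinite field such a component has infinitely many translates, while `D`
has finite support (`IsTorusInvariant.apply_eq_zero`). So `x^u` is a section exactly when `u` lies
in the polyhedron.

Sections. A section `f` has no poles on the torus, and `k[M]` is factorial, so `f` is a Laurent
polynomial (`exists_torusToFunctionField_eq`). Its order along `Y(v_i)` is at most that of each of
its monomials (`ord_torusToFunctionField_le`), hence each monomial of `f` is itself a section
(`span_character_eq_globalSections`).

Cox ring. The monomial with exponents `d_i` has degree `[∑ d_i Y(v_i)]`. This is `[D]` exactly when
`∑ d_i Y(v_i) - D = div(f)` for some `f`. Such an `f` has neither zeros nor poles on the torus, so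
it is a unit of `k[M]`, that is, `c x^u`, and `d_i = ⟨u, v_i⟩ + a_i` (`weight_coxDegree_eq_iff`).
Different `u` give different monomials because the rays span `N_ℝ`: every cone is generated by its
rays (`Fan.cone_eq_hull`) and the fan is non-degenerate. -/

lemma pos_on_convexHull {V : Type*} [AddCommGroup V] [Module ℝ V] {T : Set V} {l : V →ₗ[ℝ] ℝ}
    (hl : ∀ t ∈ T, 0 < l t) : ∀ x ∈ convexHull ℝ T, 0 < l x :=
  fun _ hx => convexHull_min (t := {x | 0 < l x}) hl (convex_halfSpace_gt l.isLinear 0) hx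

/-- Separate the compact set `conv T` from the line `ℝ s`. They are disjoint: if `a s` lies in `conv
T`, then positivity of `l` forces `a > 0`, and `s` would lie in the cone over `T`. The separating
functional is nonnegative on the whole line, hence zero at `s`. -/
lemma exists_functional_vanishing_of_normed {E : Type*} [NormedAddCommGroup E] [NormedSpace ℝ E]
    [FiniteDimensional ℝ E] {T : Set E} (hT : T.Finite) {s : E}
    {l : E →ₗ[ℝ] ℝ} (hs : 0 < l s) (hl : ∀ t ∈ T, 0 < l t)
    (hsT : s ∉ PointedCone.hull ℝ T) :
    ∃ w : E →ₗ[ℝ] ℝ, w s = 0 ∧ ∀ t ∈ T, 0 < w t := by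
  let C : ProperCone ℝ E :=
    { toSubmodule := ((ℝ ∙ s).restrictScalars _)
      isClosed' := Submodule.closed_of_finiteDimensional (ℝ ∙ s) }
  have hC : ∀ x, x ∈ C ↔ ∃ a : ℝ, a • s = x := fun x => Submodule.mem_span_singleton
  have hdisj : Disjoint (convexHull ℝ T) (C : Set E) := by
    rw [Set.disjoint_left]
    intro x hx hxC
    obtain ⟨a, rfl⟩ := (hC x).1 hxC
    have h1 := pos_on_convexHull hl _ hx
    have ha : 0 < a := by
      rw [map_smul, smul_eq_mul] at h1
      exact pos_of_mul_pos_left h1 hs.le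
    have h2 : a • s ∈ PointedCone.hull ℝ T :=
      convexHull_min PointedCone.subset_hull (PointedCone.hull ℝ T).convex hx
    apply hsT
    have h3 := (PointedCone.hull ℝ T).smul_mem (inv_pos.2 ha).le h2
    rwa [smul_smul, inv_mul_cancel₀ ha.ne', one_smul] at h3
  obtain ⟨f, hf, hfK⟩ := C.hyperplane_separation (convex_convexHull ℝ _)
    (hT.isCompact_convexHull (𝕜 := ℝ)) hdisj
  refine ⟨-(f : E →ₗ[ℝ] ℝ), ?_, fun t ht => ?_⟩
  · have h1 := hf s ((hC _).2 ⟨1, one_smul _ _⟩)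
    have h2 := hf (-s) ((hC _).2 ⟨-1, by simp⟩)
    rw [map_neg] at h2
    change -f s = 0
    linarith
  · have := hfK t (subset_convexHull ℝ _ ht)
    change 0 < -f t
    linarith

/-- If `s` is not in the cone over the finite set `T`, and `s` and `T` lie in an open half space,
then there is a functional that vanishes at `s` and is positive on `T`. -/
lemma exists_functional_vanishing {V : Type*} [AddCommGroup V] [Module ℝ V]
    [FiniteDimensional ℝ V] {T : Set V} (hT : T.Finite) {s : V}
    {l : V →ₗ[ℝ] ℝ} (hs : 0 < l s) (hl : ∀ t ∈ T, 0 < l t)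
    (hsT : s ∉ PointedCone.hull ℝ T) :
    ∃ w : V →ₗ[ℝ] ℝ, w s = 0 ∧ ∀ t ∈ T, 0 < w t := by
  let e : V ≃ₗ[ℝ] (Fin (Module.finrank ℝ V) → ℝ) := (Module.finBasis ℝ V).equivFun
  have hle : PointedCone.hull ℝ (e '' T) ≤
      (PointedCone.hull ℝ T).comap (e.symm : (Fin (Module.finrank ℝ V) → ℝ) →ₗ[ℝ] V) := by
    refine Submodule.span_le.2 ?_
    rintro _ ⟨t, ht, rfl⟩
    change e.symm (e t) ∈ PointedCone.hull ℝ T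
    rw [e.symm_apply_apply]
    exact PointedCone.subset_hull ht
  obtain ⟨w, hw, hwT⟩ := exists_functional_vanishing_of_normed (hT.image e) (s := e s)
    (l := l ∘ₗ (e.symm : (Fin (Module.finrank ℝ V) → ℝ) →ₗ[ℝ] V)) (by simpa using hs)
    (by rintro _ ⟨t, ht, rfl⟩; simpa using hl t ht)
    (fun h => hsT (by
      have h1 : e.symm (e s) ∈ PointedCone.hull ℝ T := hle h
      rwa [e.symm_apply_apply] at h1))
  exact ⟨w ∘ₗ (e : V →ₗ[ℝ] _), hw, fun t ht => hwT _ ⟨t, ht, rfl⟩⟩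

variable {N : Type} [AddCommGroup N]

lemma toReal_zsmul (n : ℤ) (v : N) : toReal (n • v) = (n : ℝ) • toReal v := by
  simp only [toReal]
  rw [TensorProduct.tmul_smul, ← Int.cast_smul_eq_zsmul ℝ]

lemma rayCone_zsmul {n : ℤ} (hn : 0 < n) (v : N) : rayCone (n • v) = rayCone v := by
  have hn' : (0 : ℝ) < n := by exact_mod_cast hn
  apply le_antisymm
  · refine Submodule.span_le.2 ?_
    rintro _ ⟨_, rfl, rfl⟩
    rw [toReal_zsmul]
    exact (rayCone v).smul_mem hn'.le (toReal_mem_hull rfl)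
  · refine Submodule.span_le.2 ?_
    rintro _ ⟨w, hw, rfl⟩
    obtain rfl : w = v := hw
    have h := (rayCone (n • w)).smul_mem (inv_pos.2 hn').le (toReal_mem_hull rfl)
    rwa [toReal_zsmul, smul_smul, inv_mul_cancel₀ hn'.ne', one_smul] at h

lemma IsPrimitive.neg {v : N} (hv : IsPrimitive v) : IsPrimitive (-v) := fun n w h =>
  (IsUnit.neg_iff n).1 (hv (-n) w (by rw [neg_smul, ← h, neg_neg]))

/-- Each nonzero lattice vector is a positive multiple of a primitive one. -/
lemma exists_isPrimitive [Module.Finite ℤ N] [Module.Free ℤ N] {s : N} (hs : s ≠ 0) :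
    ∃ (n : ℤ) (v : N), 0 < n ∧ IsPrimitive v ∧ s = n • v := by
  -- Induction on the sum of the absolute values of the coordinates: dividing by a nonunit `n` at
  -- least halves it. A negative `n` is absorbed by replacing `v` with `-v`.
  let b := Module.finBasis ℤ N
  induction hm : ∑ i, (b.repr s i).natAbs using Nat.strong_induction_on generalizing s with
  | _ m ih =>
    subst hm
    by_cases hp : IsPrimitive s
    · exact ⟨1, s, one_pos, hp, (one_smul _ _).symm⟩
    simp only [IsPrimitive, not_forall] at hp
    obtain ⟨n, w, rfl, hn⟩ := hp
    have hw : w ≠ 0 := fun h => hs (by rw [h, smul_zero])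
    have hn0 : n ≠ 0 := fun h => hs (by rw [h, zero_smul])
    have hlt : ∑ i, (b.repr w i).natAbs < ∑ i, (b.repr (n • w) i).natAbs := by
      simp only [map_smul, Finsupp.smul_apply, smul_eq_mul, Int.natAbs_mul, ← Finset.mul_sum]
      have h1 : 0 < ∑ i, (b.repr w i).natAbs := by
        obtain ⟨i, hi⟩ : ∃ i, b.repr w i ≠ 0 := by
          by_contra! h
          exact hw (b.repr.map_eq_zero_iff.1 (Finsupp.ext h))
        exact Finset.sum_pos' (fun _ _ => Nat.zero_le _)
          ⟨i, Finset.mem_univ _, Int.natAbs_pos.2 hi⟩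
      have h2 : n.natAbs ≠ 1 := fun h => hn (Int.isUnit_iff_natAbs_eq.2 h)
      have h3 : 2 ≤ n.natAbs := by have := Int.natAbs_pos.2 hn0; omega
      nlinarith
    obtain ⟨m, v, hm, hv, rfl⟩ := ih _ hlt hw rfl
    rcases lt_or_gt_of_ne hn0 with h | h
    · exact ⟨-n * m, -v, mul_pos (by omega) hm, hv.neg, by rw [smul_smul]; simp⟩
    · exact ⟨n * m, v, mul_pos h hm, hv, by rw [smul_smul]⟩

/-- A cone of a fan is generated by the rays of the fan that it contains. -/
lemma Fan.cone_eq_hull [Module.Finite ℤ N] [Module.Free ℤ N] (Δ : Fan N) (σ : Δ.Cone) :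
    σ.1 = PointedCone.hull ℝ (toReal '' {v | ∃ ρ : Δ.Ray, ρ.gen = v ∧ ρ.cone ≤ σ}) := by
  classical
  obtain ⟨l, hl, hl0⟩ := Δ.isFace_of_le (Δ.zeroCone_le σ)
  -- a generating set with as few elements as possible
  obtain ⟨S, hS, hmin⟩ : ∃ S : Finset N, σ.1 = PointedCone.hull ℝ (toReal '' (S : Set N)) ∧
      ∀ S' : Finset N, σ.1 = PointedCone.hull ℝ (toReal '' (S' : Set N)) → S.card ≤ S'.card := by
    obtain ⟨S, hS, h⟩ := exists_minimalFor_of_wellFoundedLT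
      (fun S : Finset N => σ.1 = PointedCone.hull ℝ (toReal '' (S : Set N))) Finset.card
      (Δ.rational _ σ.2)
    exact ⟨S, hS, fun S' hS' => (le_total _ _).elim id fun h' => h hS' h'⟩
  -- By minimality of `S`, no generator is redundant.
  have hred : ∀ s ∈ S, toReal s ∉ PointedCone.hull ℝ (toReal '' ((S.erase s : Finset N) : Set N)) := by
    intro s hs hmem
    have : σ.1 = PointedCone.hull ℝ (toReal '' ((S.erase s : Finset N) : Set N)) := by
      refine hS.trans (le_antisymm (Submodule.span_le.2 ?_)
        (Submodule.span_mono (Set.image_mono (by simp))))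
      rintro _ ⟨t, ht, rfl⟩
      by_cases h : t = s
      · exact h ▸ hmem
      · exact toReal_mem_hull (by simpa [h] using ht)
    have h1 := hmin _ this
    have h2 := Finset.card_erase_lt_of_mem hs
    omega
  have hmemσ : ∀ s ∈ S, toReal s ∈ σ.1 := fun s hs => by rw [hS]; exact toReal_mem_hull hs
  -- Strong convexity enters here: `l` cuts out the face `{0}`, so it vanishes on `σ` only at the
  -- origin, and the origin would be a redundant generator.
  have hpos : ∀ s ∈ S, 0 < l (toReal s) := by
    intro s hs
    refine lt_of_le_of_ne (hl _ (hmemσ s hs)) fun h => ?_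
    have h1 : toReal s ∈ Δ.zeroCone.1 := (hl0 _).2 ⟨hmemσ s hs, h.symm⟩
    have h2 : toReal s = 0 := (Submodule.mem_bot _).1 h1
    exact hred s hs (h2 ▸ zero_mem _)
  have hray : ∀ s ∈ S, ∃ (n : ℤ) (ρ : Δ.Ray), 0 < n ∧ s = n • ρ.gen ∧ ρ.cone ≤ σ := by
    intro s hs
    -- The functional `w` vanishes at `s` and is positive on all other generators, so it cuts out
    -- the ray through `s` as a face of `σ`. That ray therefore belongs to the fan.
    obtain ⟨w, hw0, hw⟩ := exists_functional_vanishing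
      (T := toReal '' ((S.erase s : Finset N) : Set N)) ((Finset.finite_toSet _).image _)
      (hpos s hs) (by rintro _ ⟨t, ht, rfl⟩; exact hpos t (Finset.mem_of_mem_erase ht)) (hred s hs)
    have hwS : ∀ t ∈ (S : Set N), 0 ≤ w (toReal t) := by
      intro t ht
      by_cases h : t = s
      · exact h ▸ hw0.ge
      · exact (hw _ ⟨t, by simpa [h] using ht, rfl⟩).le
    have hsub : {t ∈ (S : Set N) | w (toReal t) = 0} ⊆ {s} := by
      rintro t ⟨ht, ht0⟩
      by_contra h
      exact (hw _ ⟨t, Finset.mem_coe.2 (Finset.mem_erase.2 ⟨h, ht⟩), rfl⟩).ne' ht0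
    have hle : rayCone s ≤ σ.1 := by
      refine Submodule.span_le.2 ?_
      rintro _ ⟨_, rfl, rfl⟩
      exact hmemσ _ hs
    have hface : IsFace (rayCone s) σ.1 := by
      refine ⟨w, fun x hx => nonneg_on_hull hwS x (hS ▸ hx), fun x => ⟨fun hx => ⟨hle hx, ?_⟩,
        fun hx => Submodule.span_mono (Set.image_mono hsub)
          (mem_hull_of_eq_zero hwS x (hS ▸ hx.1) hx.2)⟩⟩
      apply le_antisymm
      · have := nonneg_on_hull (w := -w) (S := {s}) (by simp [hw0]) x hx
        simpa using this
      · exact nonneg_on_hull (S := {s}) (by simp [hw0]) x hx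
    have hs0 : s ≠ 0 := fun h => (hpos s hs).ne' (by simp [h, toReal])
    obtain ⟨n, v, hn, hv, rfl⟩ := exists_isPrimitive hs0
    rw [rayCone_zsmul hn] at hface hle
    exact ⟨n, ⟨v, hv, Δ.face_mem _ σ.2 _ hface⟩, hn, rfl, hle⟩
  apply le_antisymm
  · rw [hS]
    refine Submodule.span_le.2 ?_
    rintro _ ⟨s, hs, rfl⟩
    obtain ⟨n, ρ, hn, rfl, hρ⟩ := hray s hs
    rw [toReal_zsmul]
    exact PointedCone.smul_mem _ (by exact_mod_cast hn.le) (toReal_mem_hull ⟨ρ, rfl, hρ⟩)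
  · refine Submodule.span_le.2 ?_
    rintro _ ⟨_, ⟨ρ, rfl, hρ⟩, rfl⟩
    exact (show rayCone ρ.gen ≤ σ.1 from hρ) (toReal_mem_hull rfl)

/-- On a non-degenerate fan, a lattice functional is determined by its values on the rays. -/
lemma Fan.IsNondegenerate.eq_of_rays [Module.Finite ℤ N] [Module.Free ℤ N] {Δ : Fan N}
    (hΔ : Δ.IsNondegenerate) {u w : DualLattice N} (h : ∀ ρ : Δ.Ray, u ρ.gen = w ρ.gen) :
    u = w := by
  have key : ∀ x : RealSpan N, realFunctional (u - w) x = 0 := by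
    -- Since cones are generated by rays, `u - w` vanishes on every cone, hence on their span, which
    -- is all of `N_ℝ`.
    have : Submodule.span ℝ (⋃ σ ∈ Δ.cones, (σ : Set (RealSpan N))) ≤
        LinearMap.ker (realFunctional (u - w)) := by
      refine Submodule.span_le.2 (Set.iUnion₂_subset fun σ hσ x hx => ?_)
      have hx' : x ∈ (⟨σ, hσ⟩ : Δ.Cone).1 := hx
      rw [Δ.cone_eq_hull] at hx'
      have h0 : ∀ s ∈ {v | ∃ ρ : Δ.Ray, ρ.gen = v ∧ ρ.cone ≤ (⟨σ, hσ⟩ : Δ.Cone)},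
          realFunctional (u - w) (toReal s) = 0 := by
        rintro _ ⟨ρ, rfl, -⟩
        simp [h ρ]
      change realFunctional (u - w) x = 0
      apply le_antisymm
      · have := nonneg_on_hull (w := -realFunctional (u - w)) (fun s hs => by
          rw [LinearMap.neg_apply, h0 s hs, neg_zero]) x hx'
        simpa using this
      · exact nonneg_on_hull (fun s hs => (h0 s hs).ge) x hx'
    rw [hΔ] at this
    exact fun x => this trivial
  ext v
  have := key (toReal v)
  rw [realFunctional_toReal] at this
  have h1 : (u - w) v = 0 := by exact_mod_cast this
  simpa [sub_eq_zero] using h1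

end RayGenerators

/-! ### Units and factoriality of the Laurent polynomial ring -/

section MonoidAlgebras

/-- If `f` had two terms, two different pairs of exponents from `f` and `g` would have sums that are
attained only once. At these sums the coefficient of `f * g` is a nonzero product, so both sums
equal `0`, which contradicts their uniqueness. -/
lemma exists_eq_single_of_mul_eq_one {k : Type*} [Field k] {G : Type*} [AddMonoid G]
    [TwoUniqueSums G] {f g : AddMonoidAlgebra k G} (h : f * g = 1) :
    ∃ (u : G) (c : k), c ≠ 0 ∧ f = AddMonoidAlgebra.single u c := by
  classical
  have hf : f ≠ 0 := by rintro rfl; simp at h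
  have hg : g ≠ 0 := by rintro rfl; simp at h
  have hf' : 0 < f.coeff.support.card := by
    rw [Finset.card_pos, Finsupp.support_nonempty_iff]
    simpa using hf
  have hg' : 0 < g.coeff.support.card := by
    rw [Finset.card_pos, Finsupp.support_nonempty_iff]
    simpa using hg
  have hcard : f.coeff.support.card = 1 := by
    by_contra hne
    obtain ⟨p, hp, q, hq, hpq, hup, huq⟩ := TwoUniqueSums.uniqueAdd_of_one_lt_card
      (A := f.coeff.support) (B := g.coeff.support) (by nlinarith [show 2 ≤ f.coeff.support.card by omega])
    rw [Finset.mem_product] at hp hq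
    have key : ∀ r : G × G, r.1 ∈ f.coeff.support → r.2 ∈ g.coeff.support →
        UniqueAdd f.coeff.support g.coeff.support r.1 r.2 → r.1 + r.2 = 0 := by
      intro r h1 h2 hr
      have h3 := AddMonoidAlgebra.coeff_mul_add_of_uniqueAdd hr
      rw [h, AddMonoidAlgebra.one_def, AddMonoidAlgebra.coeff_single, Finsupp.single_apply] at h3
      by_contra h4
      rw [if_neg (Ne.symm h4)] at h3
      exact mul_ne_zero (Finsupp.mem_support_iff.1 h1) (Finsupp.mem_support_iff.1 h2) h3.symm
    have := hup hq.1 hq.2 ((key q hq.1 hq.2 huq).trans (key p hp.1 hp.2 hup).symm)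
    exact hpq (Prod.ext this.1.symm this.2.symm)
  obtain ⟨u, c, hc, hfu⟩ := Finsupp.card_support_eq_one'.1 hcard
  exact ⟨u, c, hc, AddMonoidAlgebra.coeff_injective (by rw [hfu]; rfl)⟩

/-- A fraction whose denominator can be chosen prime to each given prime element is integral. -/
lemma exists_algebraMap_eq_of_forall_prime {R K : Type*} [CommRing R] [IsDomain R]
    [UniqueFactorizationMonoid R] [Field K] [Algebra R K] [IsFractionRing R K] {f : K}
    (h : ∀ p : R, Prime p → ∃ a b : R, ¬ p ∣ b ∧ f * algebraMap R K b = algebraMap R K a) :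
    ∃ a, algebraMap R K a = f := by
  -- In lowest terms `f = a / b`. A prime `p` dividing `b` would divide `a b' = a' b` with `p ∤ b'`,
  -- hence `a`, so `b` is a unit.
  obtain ⟨a, b, hab, rfl⟩ := IsFractionRing.exists_reduced_fraction (A := R) f
  have hinj := IsFractionRing.injective R K
  have hbu : IsUnit (b : R) := by
    by_contra hb
    obtain ⟨p, hp, hpb⟩ := WfDvdMonoid.exists_irreducible_factor hb (nonZeroDivisors.ne_zero b.2)
    have hp' : Prime p := UniqueFactorizationMonoid.irreducible_iff_prime.1 hp
    obtain ⟨a', b', hb', he⟩ := h p hp'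
    have h1 : a * b' = a' * b := hinj (by
      rw [map_mul, map_mul, ← he, mul_right_comm, IsLocalization.mk'_spec])
    have h2 : p ∣ a := (hp'.dvd_or_dvd (h1 ▸ hpb.mul_left a')).resolve_right hb'
    exact hp.not_isUnit (hab h2 hpb)
  obtain ⟨c, hc⟩ := hbu.exists_left_inv
  refine ⟨c * a, ?_⟩
  rw [IsLocalization.eq_mk'_iff_mul_eq, ← map_mul, mul_right_comm, hc, one_mul]

variable {k : Type u} [Field k]

/-- Induction on `n`: `k[ℤ^(n+1)]` is the ring of Laurent polynomials over `k[ℤ^n]`, a localization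
of a polynomial ring over a factorial ring. -/
lemma uniqueFactorizationMonoid_groupAlgebra_fin (n : ℕ) :
    UniqueFactorizationMonoid (AddMonoidAlgebra k (Fin n → ℤ)) := by
  induction n with
  | zero =>
    exact (AddMonoidAlgebra.uniqueRingEquiv (R := k)
      (Fin 0 → ℤ)).symm.toMulEquiv.uniqueFactorizationMonoid inferInstance
  | succ n ih =>
    have h1 : UniqueFactorizationMonoid (LaurentPolynomial (AddMonoidAlgebra k (Fin n → ℤ))) :=
      UniqueFactorizationMonoid.of_isLocalization
        (Submonoid.powers (Polynomial.X : Polynomial (AddMonoidAlgebra k (Fin n → ℤ)))) _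
    exact ((AddMonoidAlgebra.curryRingEquiv (R := k) (M := ℤ) (N := Fin n → ℤ)).symm.trans
      (AddMonoidAlgebra.mapDomainRingEquiv k
        (Fin.consLinearEquiv ℤ
          (fun _ : Fin (n + 1) => ℤ)).toAddEquiv)).toMulEquiv.uniqueFactorizationMonoid h1

variable {N : Type} [AddCommGroup N]

/-- The semigroup of the zero cone is the whole dual lattice. -/
def dualMonoidBotEquiv : dualMonoid (⊥ : PointedCone ℝ (RealSpan N)) ≃+ DualLattice N where
  toFun u := u
  invFun u := ⟨u, mem_dualMonoid_bot u⟩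
  left_inv _ := rfl
  right_inv _ := rfl
  map_add' _ _ := rfl

lemma uniqueFactorizationMonoid_chartRing_bot [Module.Finite ℤ N] [Module.Free ℤ N] :
    UniqueFactorizationMonoid (ChartRing k (⊥ : PointedCone ℝ (RealSpan N))) :=
  (AddMonoidAlgebra.mapDomainRingEquiv k
    ((Module.finBasis ℤ (DualLattice N)).equivFun.symm.toAddEquiv.trans
      dualMonoidBotEquiv.symm)).toMulEquiv.uniqueFactorizationMonoid
    (uniqueFactorizationMonoid_groupAlgebra_fin (k := k) (Module.finrank ℤ (DualLattice N)))

/-- The two-unique-sums property of the lattice `M` passes to its submonoids. -/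
lemma exists_eq_single_of_mul_eq_one_chartRing [Module.Finite ℤ N] [Module.Free ℤ N]
    {σ : PointedCone ℝ (RealSpan N)} {f g : ChartRing k σ} (h : f * g = 1) :
    ∃ (u : dualMonoid σ) (c : k), c ≠ 0 ∧ f = AddMonoidAlgebra.single u c := by
  have h1 : TwoUniqueSums (DualLattice N) := UniqueSums.toTwoUniqueSums_of_addGroup
  have : TwoUniqueSums (dualMonoid σ) := TwoUniqueSums.of_injective_addHom
    ((dualMonoid σ).subtype : (dualMonoid σ) →ₙ+ DualLattice N) Subtype.val_injective h1
  exact exists_eq_single_of_mul_eq_one h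

end MonoidAlgebras

/-! ### Ideals and their translates under the torus -/

section TorusStable

variable {k : Type u} [Field k] {N : Type} [AddCommGroup N]

lemma chartAction_coeff (t : TorusPoint k N) (σ : PointedCone ℝ (RealSpan N)) (f : ChartRing k σ)
    (u : dualMonoid σ) : (chartAction t σ f).coeff u =
      t (Multiplicative.ofAdd (u : DualLattice N)) * f.coeff u := by
  classical
  induction f using AddMonoidAlgebra.induction_linear with
  | zero => simp
  | add f g hf hg => simp [hf, hg, mul_add]
  | single w c =>
    rw [chartAction_single, AddMonoidAlgebra.coeff_single, AddMonoidAlgebra.coeff_single,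
      Finsupp.single_apply, Finsupp.single_apply]
    split_ifs with h
    · rw [h, mul_comm]
    · simp

lemma chartAction_mul (s t : TorusPoint k N) (σ : PointedCone ℝ (RealSpan N)) (f : ChartRing k σ) :
    chartAction (s * t) σ f = chartAction s σ (chartAction t σ f) := by
  refine AddMonoidAlgebra.coeff_injective (Finsupp.ext fun u => ?_)
  simp [chartAction_coeff, mul_assoc]

lemma chartAction_one (σ : PointedCone ℝ (RealSpan N)) (f : ChartRing k σ) :
    chartAction (1 : TorusPoint k N) σ f = f := by
  refine AddMonoidAlgebra.coeff_injective (Finsupp.ext fun u => ?_)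
  simp [chartAction_coeff]

/-- An ideal which is stable under sufficiently many points of the torus contains a monomial. -/
lemma exists_single_mem_of_stable {σ : PointedCone ℝ (RealSpan N)} {P : Ideal (ChartRing k σ)}
    (hP : P ≠ ⊥) (h : ∀ u w : dualMonoid σ, u ≠ w → ∃ t : TorusPoint k N,
      (∀ f ∈ P, chartAction t σ f ∈ P) ∧
        t (Multiplicative.ofAdd (u : DualLattice N)) ≠
          t (Multiplicative.ofAdd (w : DualLattice N))) :
    ∃ u : dualMonoid σ, AddMonoidAlgebra.single u (1 : k) ∈ P := by
  classical
  -- A nonzero element of `P` with the fewest terms turns out to have only one.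
  obtain ⟨f, ⟨hfP, hf0⟩, hmin⟩ := exists_minimalFor_of_wellFoundedLT
    (fun f : ChartRing k σ => f ∈ P ∧ f ≠ 0) (fun f => f.coeff.support.card)
    (Submodule.exists_mem_ne_zero_of_ne_bot hP)
  obtain ⟨u, hu⟩ : f.coeff.support.Nonempty := by
    rw [Finsupp.support_nonempty_iff]
    simpa using hf0
  have hsingle : ∀ w, w ≠ u → f.coeff w = 0 := by
    intro w hw
    by_contra hfw
    obtain ⟨t, ht, htu⟩ := h w u hw
    -- The combination `t · f - t(u) f` stays in `P`, loses the term at `u`, gains none, and keeps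
    -- the term at `w` because `t(w) ≠ t(u)`. It contradicts the minimality of `f`.
    let g := chartAction t σ f - (t (Multiplicative.ofAdd (u : DualLattice N)) : k) • f
    have hgP : g ∈ P := P.sub_mem (ht f hfP) (Submodule.smul_of_tower_mem P _ hfP)
    have hg : ∀ w', g.coeff w' = (t (Multiplicative.ofAdd (w' : DualLattice N)) -
        t (Multiplicative.ofAdd (u : DualLattice N)) : k) * f.coeff w' := by
      intro w'
      simp [g, chartAction_coeff, sub_mul]
    have hg0 : g ≠ 0 := by
      intro h0
      have := hg w
      rw [h0] at this
      refine mul_ne_zero (sub_ne_zero.2 fun h => htu (Units.ext h)) hfw ?_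
      simpa using this.symm
    have hlt : g.coeff.support.card < f.coeff.support.card := by
      refine Finset.card_lt_card ⟨fun w' hw' => ?_, fun hsub => ?_⟩
      · rw [Finsupp.mem_support_iff, hg] at hw'
        exact Finsupp.mem_support_iff.2 (right_ne_zero_of_mul hw')
      · have := hsub hu
        rw [Finsupp.mem_support_iff, hg] at this
        simp at this
    exact absurd (hmin ⟨hgP, hg0⟩ hlt.le) (not_le.2 hlt)
  refine ⟨u, ?_⟩
  have hfu : f = AddMonoidAlgebra.single u (f.coeff u) := by
    refine AddMonoidAlgebra.coeff_injective (Finsupp.ext fun w => ?_)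
    rw [AddMonoidAlgebra.coeff_single, Finsupp.single_apply]
    split_ifs with h
    · rw [h]
    · exact hsingle w (Ne.symm h)
  have := Submodule.smul_of_tower_mem P (f.coeff u)⁻¹ hfP
  rwa [hfu, AddMonoidAlgebra.smul_single, ← hfu, smul_eq_mul,
    inv_mul_cancel₀ (Finsupp.mem_support_iff.1 hu)] at this

/-- The one-parameter subgroup `c ↦ (u ↦ c ^ ⟨u, v⟩)` of the torus. -/
def oneParameter (v : N) (c : kˣ) : TorusPoint k N where
  toFun u := c ^ (u.toAdd v)
  map_one' := by simp
  map_mul' u w := by simp [zpow_add]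

lemma oneParameter_ofAdd (v : N) (c : kˣ) (u : DualLattice N) :
    oneParameter v c (Multiplicative.ofAdd u) = c ^ (u v) := rfl

lemma oneParameter_mul (v : N) (c d : kˣ) :
    oneParameter v (c * d) = oneParameter v c * oneParameter v d := by
  ext u
  simp [oneParameter, mul_zpow]

lemma oneParameter_one (v : N) : oneParameter v (1 : kˣ) = (1 : TorusPoint k N) := by
  ext u
  simp [oneParameter]

/-- The action of the points of a one-parameter subgroup, as ring automorphisms. -/
def oneParameterEquiv (v : N) (c : kˣ) (σ : PointedCone ℝ (RealSpan N)) :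
    ChartRing k σ ≃+* ChartRing k σ where
  toFun := chartAction (oneParameter v c) σ
  invFun := chartAction (oneParameter v c⁻¹) σ
  left_inv f := by
    rw [← chartAction_mul, ← oneParameter_mul, inv_mul_cancel, oneParameter_one, chartAction_one]
  right_inv f := by
    rw [← chartAction_mul, ← oneParameter_mul, mul_inv_cancel, oneParameter_one, chartAction_one]
  map_mul' := map_mul _
  map_add' := map_add _

/-- These are roots of unity in a field. The sign of `m` does not matter, since inverting preserves
the equation. -/
lemma finite_setOf_zpow_eq_one {m : ℤ} (hm : m ≠ 0) : {c : kˣ | c ^ m = 1}.Finite := by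
  have : NeZero m.natAbs := ⟨Int.natAbs_ne_zero.2 hm⟩
  have hfin : Finite (rootsOfUnity m.natAbs k) := inferInstance
  refine (show (rootsOfUnity m.natAbs k : Set kˣ).Finite from hfin).subset fun c hc => ?_
  rw [SetLike.mem_coe, mem_rootsOfUnity, ← zpow_natCast]
  have hc : c ^ m = 1 := hc
  rcases Int.natAbs_eq m with h | h
  · rw [← h, hc]
  · rw [← inv_inj, ← zpow_neg, ← h, hc, inv_one]

/-- A nonzero proper ideal of the coordinate ring of the torus has infinitely many translates. -/
lemma exists_infinite_translates [Infinite k] [Module.Finite ℤ N] [Module.Free ℤ N]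
    {P : Ideal (ChartRing k (⊥ : PointedCone ℝ (RealSpan N)))} (hP : P ≠ ⊥) (hP' : P ≠ ⊤) :
    ∃ v : N, (Set.range fun c : kˣ => P.comap (chartAction (oneParameter v c) ⊥)).Infinite := by
  have : Infinite kˣ := by
    refine (Equiv.infinite_iff (unitsEquivNeZero (G₀ := k))).2 ?_
    exact Set.infinite_coe_iff.2 (Set.finite_singleton (0 : k)).infinite_compl
  by_contra! hfin
  -- With only finitely many translates along each one-parameter subgroup, infinitely many `c` give
  -- the same translate, and their quotients stabilize `P`. This leaves enough stabilizing points to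
  -- separate any two characters, so `P` contains a monomial, which is a unit of `k[M]`.
  obtain ⟨u, hu⟩ := exists_single_mem_of_stable hP fun u w huw => by
    obtain ⟨v, hv⟩ : ∃ v, (u : DualLattice N) v ≠ (w : DualLattice N) v := by
      by_contra! h
      exact huw (Subtype.ext (LinearMap.ext h))
    have := (hfin v).to_subtype
    obtain ⟨⟨Q, hQ⟩, hinf⟩ := Finite.exists_infinite_fiber
      (Set.rangeFactorization fun c : kˣ => P.comap (chartAction (oneParameter v c) ⊥))
    rw [Set.infinite_coe_iff] at hinf
    obtain ⟨c₀, hc₀⟩ := hinf.nonempty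
    have hm : (u : DualLattice N) v - (w : DualLattice N) v ≠ 0 := sub_ne_zero.2 hv
    -- The one-parameter point of `c / c₀` fails to separate `u` from `w` only if `(c / c₀) ^ (⟨u,
    -- v⟩ - ⟨w, v⟩) = 1`, which excludes finitely many `c`.
    obtain ⟨c, hc, hc'⟩ := hinf.exists_notMem_finite
      ((finite_setOf_zpow_eq_one (k := k) hm).image (· * c₀))
    have hcc : P.comap (chartAction (oneParameter v c) ⊥) =
        P.comap (chartAction (oneParameter v c₀) ⊥) :=
      congrArg Subtype.val ((show _ = _ from hc).trans (show _ = _ from hc₀).symm)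
    have hd : (c * c₀⁻¹) ^ ((u : DualLattice N) v - (w : DualLattice N) v) ≠ 1 := fun h =>
      hc' ⟨c * c₀⁻¹, h, by simp⟩
    refine ⟨oneParameter v (c * c₀⁻¹), fun f hf => ?_, fun h => hd ?_⟩
    · have h1 : chartAction (oneParameter v c₀⁻¹) ⊥ f ∈
          P.comap (chartAction (oneParameter v c₀) ⊥) := by
        rw [Ideal.mem_comap, ← chartAction_mul, ← oneParameter_mul, mul_inv_cancel,
          oneParameter_one, chartAction_one]
        exact hf
      rw [← hcc, Ideal.mem_comap, ← chartAction_mul, ← oneParameter_mul] at h1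
      exact h1
    · rw [oneParameter_ofAdd, oneParameter_ofAdd] at h
      rw [zpow_sub, h, mul_inv_cancel]
  refine hP' (P.eq_top_of_isUnit_mem hu (.of_mul_eq_one (AddMonoidAlgebra.single
    (⟨-u, mem_dualMonoid_bot _⟩ : dualMonoid (⊥ : PointedCone ℝ (RealSpan N))) 1) ?_))
  rw [AddMonoidAlgebra.single_mul_single, AddMonoidAlgebra.one_def, one_mul]
  congr 1
  ext1
  simp

end TorusStable

/-! ### Local rings and orders of vanishing in an affine chart -/

section AffineCharts

variable {R : Type u} [CommRing R] {X : Scheme.{u}} (j : Spec (.of R) ⟶ X) [IsOpenImmersion j]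

/-- The prime ideal of a point of an affine scheme. -/
def pointIdeal {R : Type u} [CommRing R] (y : Spec (.of R)) : Ideal R :=
  PrimeSpectrum.asIdeal (R := R) y

instance pointIdeal_isPrime {R : Type u} [CommRing R] (y : Spec (.of R)) : (pointIdeal y).IsPrime :=
  PrimeSpectrum.isPrime (R := R) y

lemma pointIdeal_injective {R : Type u} [CommRing R] {x y : Spec (.of R)}
    (h : pointIdeal x = pointIdeal y) : x = y :=
  PrimeSpectrum.ext (R := R) h

lemma coheight_eq_height_pointIdeal {R : Type u} [CommRing R] {X : Scheme.{u}}
    (j : Spec (.of R) ⟶ X) [IsOpenImmersion j] (y : Spec (.of R)) :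
    Order.coheight (j y) = (pointIdeal y).height :=
  (coheight_eq_of_isOpenImmersion j).trans (idealHeight_eq_coheight (.of R) y).symm

lemma apply_mem_image_top (y : Spec (.of R)) : j y ∈ j ''ᵁ ⊤ :=
  ⟨y, trivial, rfl⟩

/-- The ring homomorphism from the coordinate ring of an affine open subscheme to a local ring. -/
def specToStalk (y : Spec (.of R)) : R →+* X.presheaf.stalk (j y) :=
  ((Scheme.ΓSpecIso (.of R)).inv ≫ (j.appIso ⊤).inv ≫
    X.presheaf.germ (j ''ᵁ ⊤) (j y) (apply_mem_image_top j y)).hom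

/-- Up to the isomorphism of stalks induced by `j`, the map `specToStalk` is the localization map of
`R` at the prime of `y`. Statements about localizations are transported to `X` through this
identity. -/
lemma stalkMap_specToStalk (y : Spec (.of R)) :
    CommRingCat.ofHom (specToStalk j y) ≫ j.stalkMap y =
      (Scheme.ΓSpecIso (.of R)).inv ≫ (Spec (.of R)).presheaf.germ ⊤ y trivial := by
  have h1 : CommRingCat.ofHom (specToStalk j y) = (Scheme.ΓSpecIso (.of R)).inv ≫
    (j.appIso ⊤).inv ≫ X.presheaf.germ (j ''ᵁ ⊤) (j y) (apply_mem_image_top j y) := rfl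
  rw [h1, Category.assoc, Category.assoc, Scheme.Hom.germ_stalkMap, Scheme.Hom.appIso_inv_app_assoc]
  congr 1
  exact TopCat.Presheaf.germ_res _ _ _ _

lemma stalkMap_specToStalk_apply (y : Spec (.of R)) (r : R) :
    (j.stalkMap y).hom (specToStalk j y r) = (StructureSheaf.toStalk R y).hom r :=
  congrArg (fun f => f.hom r) (stalkMap_specToStalk j y)

lemma isUnit_specToStalk_iff (y : Spec (.of R)) (r : R) :
    IsUnit (specToStalk j y r) ↔ r ∉ pointIdeal y := by
  let : Algebra R ((Spec (.of R)).presheaf.stalk y) := StructureSheaf.stalkAlgebra R y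
  have : IsLocalization.AtPrime ((Spec (.of R)).presheaf.stalk y) (pointIdeal y) :=
    StructureSheaf.IsLocalization.to_stalk R y
  rw [← isUnit_map_iff (j.stalkMap y).hom, stalkMap_specToStalk_apply]
  exact IsLocalization.AtPrime.isUnit_to_map_iff
    ((Spec (.of R)).presheaf.stalk y) (pointIdeal y) r

lemma exists_mul_specToStalk_eq (y : Spec (.of R)) (s : X.presheaf.stalk (j y)) :
    ∃ a b : R, b ∉ pointIdeal y ∧ s * specToStalk j y b = specToStalk j y a := by
  let : Algebra R ((Spec (.of R)).presheaf.stalk y) := StructureSheaf.stalkAlgebra R y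
  have : IsLocalization.AtPrime ((Spec (.of R)).presheaf.stalk y) (pointIdeal y) :=
    StructureSheaf.IsLocalization.to_stalk R y
  obtain ⟨⟨a, b⟩, h⟩ := IsLocalization.surj (M := (pointIdeal y).primeCompl)
    (S := (Spec (.of R)).presheaf.stalk y) ((j.stalkMap y).hom s)
  refine ⟨a, b, b.2, ?_⟩
  have hinj : Function.Injective (j.stalkMap y).hom :=
    (asIso (j.stalkMap y)).commRingCatIsoToRingEquiv.injective
  apply hinj
  rw [map_mul, stalkMap_specToStalk_apply, stalkMap_specToStalk_apply]
  exact h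

/-- Every germ is a fraction `a / b` with `b` outside the prime. If the germ is not a unit then `a`
lies in the prime, so `p` divides `a`. -/
lemma maximalIdeal_eq_span_specToStalk (y : Spec (.of R)) {p : R}
    (hp : (pointIdeal y) = Ideal.span {p}) :
    IsLocalRing.maximalIdeal (X.presheaf.stalk (j y)) = Ideal.span {specToStalk j y p} := by
  apply le_antisymm
  · intro s hs
    obtain ⟨a, b, hb, h⟩ := exists_mul_specToStalk_eq j y s
    have ha : a ∈ (pointIdeal y) := by
      by_contra ha
      rw [← isUnit_specToStalk_iff j, ← h] at ha
      exact hs (isUnit_of_mul_isUnit_left ha)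
    rw [hp, Ideal.mem_span_singleton] at ha
    obtain ⟨c, rfl⟩ := ha
    rw [Ideal.mem_span_singleton]
    have hb' := (isUnit_specToStalk_iff j y b).2 hb
    rw [← hb'.dvd_mul_right, h, map_mul]
    exact dvd_mul_right _ _
  · rw [Ideal.span_le, Set.singleton_subset_iff]
    change ¬ IsUnit _
    rw [isUnit_specToStalk_iff, not_not, hp]
    exact Ideal.mem_span_singleton_self p

variable [AlgebraicGeometry.IsIntegral X] [IsDomain R]

/-- The inclusion of the coordinate ring of an affine open subscheme in the function field. -/
def specToFunctionField : R →+* X.functionField :=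
  haveI : Nonempty (j ''ᵁ ⊤) := ⟨⟨j (genericPoint _), ⟨_, trivial, rfl⟩⟩⟩
  ((Scheme.ΓSpecIso (.of R)).inv ≫ (j.appIso ⊤).inv ≫ X.germToFunctionField (j ''ᵁ ⊤)).hom

lemma algebraMap_specToStalk (y : Spec (.of R)) (r : R) :
    algebraMap (X.presheaf.stalk (j y)) X.functionField (specToStalk j y r) =
      specToFunctionField j r :=
  haveI : Nonempty (j ''ᵁ ⊤) := ⟨⟨j (genericPoint _), ⟨_, trivial, rfl⟩⟩⟩
  Scheme.algebraMap_germ_eq_germToFunctionField (X := X) (U := j ''ᵁ ⊤) (x := j y)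
    ⟨y, trivial, rfl⟩ _

lemma specToFunctionField_injective : Function.Injective (specToFunctionField j) := by
  have : Nonempty (j ''ᵁ ⊤) := ⟨⟨j (genericPoint _), ⟨_, trivial, rfl⟩⟩⟩
  exact (Scheme.germToFunctionField_injective X (j ''ᵁ ⊤)).comp
    ((((Scheme.ΓSpecIso (.of R)).symm ≪≫
      (j.appIso ⊤).symm).commRingCatIsoToRingEquiv).injective)

lemma specToFunctionField_isFractionRing :
    letI := (specToFunctionField j).toAlgebra
    IsFractionRing R X.functionField := by
  have : Nonempty (j ''ᵁ ⊤) := ⟨⟨j (genericPoint _), ⟨_, trivial, rfl⟩⟩⟩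
  let := (specToFunctionField j).toAlgebra
  have hU : IsAffineOpen (j ''ᵁ ⊤) := (isAffineOpen_top _).image_of_isOpenImmersion j
  have := functionField_isFractionRing_of_isAffineOpen X (j ''ᵁ ⊤) hU
  let e : R ≃+* Γ(X, j ''ᵁ ⊤) :=
    ((Scheme.ΓSpecIso (.of R)).symm ≪≫ (j.appIso ⊤).symm).commRingCatIsoToRingEquiv
  exact IsFractionRing.of_ringEquiv_left e fun _ => rfl

/-- A regular function on an open set that contains the affine open subscheme. -/
lemma germToFunctionField_eq_specToFunctionField {U : X.Opens} [Nonempty U]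
    (hU : ⊤ ≤ j ⁻¹ᵁ U) {a : Γ(X, U)} {r : R}
    (h : (j.appLE U ⊤ hU).hom a = (Scheme.ΓSpecIso (.of R)).inv.hom r) :
    X.germToFunctionField U a = specToFunctionField j r := by
  -- Both rational functions come from the local ring at `j y`, so it suffices to compare germs
  -- there. The map of stalks is injective, which moves the comparison to `Spec R`.
  let y := genericPoint (Spec (.of R))
  have hy : j y ∈ U := hU (show y ∈ (⊤ : (Spec (.of R)).Opens) from trivial)
  rw [← algebraMap_specToStalk j y, ← Scheme.algebraMap_germ_eq_germToFunctionField X hy]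
  congr 1
  have hinj : Function.Injective (j.stalkMap y).hom :=
    (asIso (j.stalkMap y)).commRingCatIsoToRingEquiv.injective
  apply hinj
  have h1 : X.presheaf.germ U (j y) hy ≫ j.stalkMap y =
      j.appLE U ⊤ hU ≫ (Spec (.of R)).presheaf.germ ⊤ y trivial := by
    rw [Scheme.Hom.germ_stalkMap, Scheme.Hom.appLE, Category.assoc]
    congr 1
    exact (TopCat.Presheaf.germ_res _ _ _ _).symm
  have h2 := congrArg (fun f => f.hom a) h1
  have h3 := congrArg (fun f => f.hom r) (stalkMap_specToStalk j y)
  refine h2.trans (Eq.trans ?_ h3.symm)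
  exact congrArg ((Spec (.of R)).presheaf.germ ⊤ y trivial).hom h

/-- Compatibility for nested charts: passing to a smaller affine open does not change the rational
function. -/
lemma specToFunctionField_comp {S : Type u} [CommRing S] [IsDomain S] (φ : R →+* S)
    [IsOpenImmersion (Spec.map (CommRingCat.ofHom φ))] (r : R) :
    specToFunctionField (Spec.map (CommRingCat.ofHom φ) ≫ j) (φ r) = specToFunctionField j r := by
  have : Nonempty (j ''ᵁ ⊤) := ⟨⟨j (genericPoint _), ⟨_, trivial, rfl⟩⟩⟩
  have hU : ⊤ ≤ (Spec.map (CommRingCat.ofHom φ) ≫ j) ⁻¹ᵁ (j ''ᵁ ⊤) :=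
    fun y _ => apply_mem_image_top j _
  refine (germToFunctionField_eq_specToFunctionField _ hU ?_).symm
  have hj : ⊤ ≤ j ⁻¹ᵁ (j ''ᵁ ⊤) := fun y _ => apply_mem_image_top j y
  have : (Scheme.ΓSpecIso (.of R)).inv ≫ (j.appIso ⊤).inv ≫
      (Spec.map (CommRingCat.ofHom φ) ≫ j).appLE (j ''ᵁ ⊤) ⊤ hU =
      CommRingCat.ofHom φ ≫ (Scheme.ΓSpecIso (.of S)).inv := by
    rw [← Scheme.Hom.appLE_comp_appLE _ _ _ ⊤ _ hj le_top,
      ← Category.assoc (j.appIso ⊤).inv, Scheme.Hom.appIso_inv_appLE, Scheme.ΓSpecIso_inv_naturality]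
    simp only [Scheme.Hom.appLE]
    simp
    exact Category.comp_id _
  exact congrArg (fun f => f.hom r) this

variable [IsLocallyNoetherian X]

/-- The order of vanishing of a function which is invertible at the point. -/
lemma ord_specToFunctionField_of_notMem {y : Spec (.of R)} {r : R} (hr : r ∉ (pointIdeal y)) :
    X.ord (specToFunctionField j r) (j y) = 0 := by
  by_cases hy : Order.coheight (j y) = 1
  · have hdim : Ring.KrullDimLE 1 (X.presheaf.stalk (j y)) := krullDimLE_of_coheight_le hy.le
    have hu := (isUnit_specToStalk_iff j y r).2 hr
    rw [← algebraMap_specToStalk j y, Scheme.ord_eq_iff hy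
      ((map_ne_zero_iff _ (IsFractionRing.injective _ _)).2 hu.ne_zero)]
    exact Ring.ordFrac_of_isUnit hu
  -- Away from codimension one the order is zero by convention.
  · exact Scheme.ord_eq_zero_of_coheight_neq_one hy _

variable [∀ x : X, IsIntegrallyClosed (X.presheaf.stalk x)]

/-- Normality makes the local ring a discrete valuation ring, and nonnegative order means that `f`
is integral for its valuation. Then `f` is a fraction whose denominator lies outside the maximal
ideal, hence is a unit. -/
lemma exists_algebraMap_stalk_of_ord_nonneg (z : PrimeDivisor X) {f : X.functionField}
    (hf : f ≠ 0) (h : 0 ≤ X.ord f z.1) :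
    ∃ s, algebraMap (X.presheaf.stalk z.1) X.functionField s = f := by
  have := isDiscreteValuationRing_stalk z
  have hdim : Ring.KrullDimLE 1 (X.presheaf.stalk z.1) := krullDimLE_of_coheight_le z.2.le
  rw [Scheme.le_ord_iff z.2 hf] at h
  -- `Ring.ordFrac` is multiplicative, so order `0` reads as `1`. It is the inverse of the adic
  -- valuation, which reverses the inequality.
  have h' : 1 ≤ Ring.ordFrac (X.presheaf.stalk z.1) f := h
  rw [Ring.ordFrac_eq_valuation_inv,
    one_le_inv₀ (zero_lt_iff.2 ((Valuation.ne_zero_iff _).2 hf))] at h'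
  obtain ⟨s, n, hs⟩ :=
    IsDedekindDomain.HeightOneSpectrum.exists_primeCompl_mul_eq_of_integer _ f h'
  obtain ⟨c, hc⟩ : IsUnit (n : X.presheaf.stalk z.1) := by
    by_contra hn
    exact n.2 hn
  refine ⟨s * ↑c⁻¹, ?_⟩
  have h1 : algebraMap (X.presheaf.stalk z.1) X.functionField n *
      algebraMap (X.presheaf.stalk z.1) X.functionField ↑c⁻¹ = 1 := by
    rw [← map_mul, ← hc, Units.mul_inv, map_one]
  rw [map_mul, ← hs, mul_assoc, h1, mul_one]

/-- The order of vanishing of a uniformizer. -/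
lemma ord_specToFunctionField_of_eq_span {y : Spec (.of R)} (hy : Order.coheight (j y) = 1)
    {p : R} (hp : (pointIdeal y) = Ideal.span {p}) :
    X.ord (specToFunctionField j p) (j y) = 1 := by
  have hdvr : IsDiscreteValuationRing (X.presheaf.stalk (j y)) :=
    isDiscreteValuationRing_stalk ⟨j y, hy⟩
  have hdim : Ring.KrullDimLE 1 (X.presheaf.stalk (j y)) := krullDimLE_of_coheight_le hy.le
  have hirr := (IsDiscreteValuationRing.irreducible_iff_uniformizer _).2
    (maximalIdeal_eq_span_specToStalk j y hp)
  rw [← algebraMap_specToStalk j y, Scheme.ord_eq_iff hy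
    ((map_ne_zero_iff _ (IsFractionRing.injective _ _)).2 hirr.ne_zero)]
  exact Ring.ordFrac_irreducible hirr

/-- A rational function without poles along a prime divisor, as a fraction. -/
lemma exists_mul_specToFunctionField_eq {y : Spec (.of R)} (hy : Order.coheight (j y) = 1)
    {f : X.functionField} (h : f = 0 ∨ 0 ≤ X.ord f (j y)) :
    ∃ a b : R, b ∉ (pointIdeal y) ∧ f * specToFunctionField j b = specToFunctionField j a := by
  have : ∃ s, algebraMap (X.presheaf.stalk (j y)) X.functionField s = f := by
    by_cases hf : f = 0
    · exact ⟨0, by rw [map_zero, hf]⟩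
    · exact exists_algebraMap_stalk_of_ord_nonneg ⟨j y, hy⟩ hf (h.resolve_left hf)
  obtain ⟨s, rfl⟩ := this
  obtain ⟨a, b, hb, h⟩ := exists_mul_specToStalk_eq j y s
  exact ⟨a, b, hb, by rw [← algebraMap_specToStalk j y, ← algebraMap_specToStalk j y, ← map_mul, h]⟩

/-- A rational function on a factorial affine open subscheme without poles is regular. -/
lemma exists_specToFunctionField_eq [UniqueFactorizationMonoid R] [IsNoetherianRing R] {f : X.functionField}
    (h : ∀ y : Spec (.of R), Order.coheight (j y) = 1 → 0 ≤ X.ord f (j y)) :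
    ∃ r, specToFunctionField j r = f := by
  let := (specToFunctionField j).toAlgebra
  have := specToFunctionField_isFractionRing j
  -- A prime element `p` generates a prime of height one. The order of `f` there is nonnegative, so
  -- `f` has a denominator outside `(p)`.
  refine exists_algebraMap_eq_of_forall_prime (R := R) fun p hp => ?_
  have hpr : (Ideal.span {p}).IsPrime := (Ideal.span_singleton_prime hp.ne_zero).2 hp
  let y : Spec (.of R) := (⟨Ideal.span {p}, hpr⟩ : PrimeSpectrum R)
  have hy : Order.coheight (j y) = 1 := by
    rw [coheight_eq_height_pointIdeal]
    exact Ideal.height_span_singleton_eq_one_of_mem_nonZeroDivisors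
      (mem_nonZeroDivisors_of_ne_zero hp.ne_zero) hp.not_isUnit
  obtain ⟨a, b, hb, he⟩ := exists_mul_specToFunctionField_eq j hy (Or.inr (h y hy))
  exact ⟨a, b, fun hpb => hb (Ideal.mem_span_singleton.2 hpb), he⟩

end AffineCharts

/-! ### Characters, ray divisors and invariant divisors on the toric variety -/

section ToricCharts

variable {k : Type u} [Field k] {N : Type} [AddCommGroup N]

lemma chartMap_coeff {τ σ : PointedCone ℝ (RealSpan N)} (h : τ ≤ σ) (f : ChartRing k σ)
    (u : dualMonoid σ) :
    (chartMap k h f).coeff (AddSubmonoid.inclusion (dualMonoid_anti h) u) = f.coeff u := by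
  classical
  induction f using AddMonoidAlgebra.induction_linear with
  | zero => simp
  | add f g hf hg => simp [hf, hg]
  | single w c =>
    rw [chartMap_single, AddMonoidAlgebra.coeff_single, AddMonoidAlgebra.coeff_single,
      Finsupp.single_apply, Finsupp.single_apply]
    simp only [(AddSubmonoid.inclusion_injective (dualMonoid_anti h)).eq_iff]

/-- Membership in the smaller ring can be tested on exponents, term by term. -/
lemma exists_chartMap_eq {τ σ : PointedCone ℝ (RealSpan N)} (h : τ ≤ σ) (f : ChartRing k τ)
    (hf : ∀ u, f.coeff u ≠ 0 → (u : DualLattice N) ∈ dualMonoid σ) :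
    ∃ g : ChartRing k σ, chartMap k h g = f := by
  classical
  have hf' : ∀ u ∈ f.coeff.support, (u : DualLattice N) ∈ dualMonoid σ := fun u hu =>
    hf u (Finsupp.mem_support_iff.1 hu)
  refine ⟨∑ u ∈ f.coeff.support.attach,
    AddMonoidAlgebra.single (⟨u.1, hf' u.1 u.2⟩ : dualMonoid σ) (f.coeff u.1), ?_⟩
  rw [map_sum]
  simp_rw [chartMap_single]
  exact (Finset.sum_attach _ (fun u => AddMonoidAlgebra.single u (f.coeff u))).trans
    (AddMonoidAlgebra.sum_coeff_single f)

variable [Module.Finite ℤ N] [Module.Free ℤ N] {Δ : Fan N}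

/-- All chart rings thus embed compatibly in one function field, so a character may be studied in
any chart where it is regular. -/
lemma specToFunctionField_chartMap {τ σ : Δ.Cone} (h : τ ≤ σ) (f : ChartRing k σ.1) :
    specToFunctionField (chartι k τ) (chartMap k h f) = specToFunctionField (chartι k σ) f := by
  have : IsOpenImmersion (Spec.map (CommRingCat.ofHom
      (chartMap k (show τ.1 ≤ σ.1 from h)).toRingHom)) := (chartFunctor_map k Δ (homOfLE h)).1
  -- `specToFunctionField` depends on an instance attached to the morphism, so equal morphisms are
  -- exchanged by substituting a variable.
  have key : ∀ (j : Spec (.of (ChartRing k τ.1)) ⟶ toricVariety k Δ) [IsOpenImmersion j],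
      j = chartι k τ → ∀ r, specToFunctionField j r = specToFunctionField (chartι k τ) r := by
    rintro j _ rfl r
    rfl
  rw [← key (Spec.map (CommRingCat.ofHom (chartMap k (show τ.1 ≤ σ.1 from h)).toRingHom) ≫
    chartι k σ) (chartFunctor_map_chartι k (homOfLE h))]
  exact specToFunctionField_comp (chartι k σ) (chartMap k (show τ.1 ≤ σ.1 from h)).toRingHom f

lemma torusToFunctionField_injective : Function.Injective (torusToFunctionField k Δ) :=
  specToFunctionField_injective (chartι k Δ.zeroCone)

/-- The scalars of `k(X)` come from the structure morphism and those of `k[M]` from the chart. Their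
agreement makes the embedding `k`-linear. -/
lemma torusToFunctionField_algebraMap (c : k) :
    torusToFunctionField k Δ (algebraMap k _ c) = algebraMap k _ c := by
  refine (germToFunctionField_eq_specToFunctionField (chartι k Δ.zeroCone) (U := ⊤) le_top ?_).symm
  have h1 : chartι k Δ.zeroCone ≫ structureMorphism k Δ =
      Spec.map (CommRingCat.ofHom (algebraMap k (ChartRing k Δ.zeroCone.1))) :=
    colimit.ι_desc _ _
  have h2 : (Scheme.ΓSpecIso (.of k)).inv ≫ (structureMorphism k Δ).appTop ≫
      (chartι k Δ.zeroCone).appTop =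
      CommRingCat.ofHom (algebraMap k (ChartRing k Δ.zeroCone.1)) ≫
        (Scheme.ΓSpecIso (.of (ChartRing k Δ.zeroCone.1))).inv := by
    rw [Scheme.ΓSpecIso_inv_naturality, ← h1, Scheme.Hom.comp_appTop]
  have h3 : (chartι k Δ.zeroCone).appLE ⊤ ⊤ le_top = (chartι k Δ.zeroCone).appTop := by
    simp only [Scheme.Hom.appLE]
    simp
    exact Category.comp_id _
  rw [h3]
  exact congrArg (fun f => f.hom c) h2

/-- The inclusion `k[M] → k(X)`, as a linear map. -/
def torusToFunctionFieldₗ (k : Type u) [Field k] (Δ : Fan N) :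
    ChartRing k Δ.zeroCone.1 →ₗ[k] (toricVariety k Δ).functionField where
  toFun := torusToFunctionField k Δ
  map_add' := map_add _
  map_smul' c f := by
    rw [Algebra.smul_def, map_mul, torusToFunctionField_algebraMap, ← Algebra.smul_def]
    rfl

lemma character_eq {σ : Δ.Cone} {u : DualLattice N} (hu : u ∈ dualMonoid σ.1) :
    character k Δ u =
      specToFunctionField (chartι k σ) (AddMonoidAlgebra.single (⟨u, hu⟩ : dualMonoid σ.1) 1) := by
  rw [← specToFunctionField_chartMap (Δ.zeroCone_le σ), chartMap_single]
  rfl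

lemma character_add (u w : DualLattice N) :
    character k Δ (u + w) = character k Δ u * character k Δ w := by
  rw [character, character, character, ← map_mul, AddMonoidAlgebra.single_mul_single, one_mul]
  rfl

lemma character_ne_zero (u : DualLattice N) : character k Δ u ≠ 0 := by
  rw [character, Ne, map_eq_zero_iff _ torusToFunctionField_injective]
  simp

lemma character_zero : character k Δ 0 = 1 := by
  refine mul_left_cancel₀ (character_ne_zero 0) ?_
  rw [← character_add, add_zero, mul_one]

/-- The order of vanishing of the characters along a prime divisor. -/
def characterOrd (Z : PrimeDivisor (toricVariety k Δ)) : DualLattice N →+ ℤ where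
  toFun u := (toricVariety k Δ).ord (character k Δ u) Z.1
  map_zero' := by
    have := Scheme.ord_mul (x := Z.1) (character_ne_zero (k := k) (Δ := Δ) 0) (character_ne_zero 0)
    rw [← character_add, add_zero] at this
    omega
  map_add' u w := by
    rw [character_add, Scheme.ord_mul (character_ne_zero u) (character_ne_zero w)]

lemma ord_character_torus (u : DualLattice N) (y : Spec (.of (ChartRing k Δ.zeroCone.1))) :
    (toricVariety k Δ).ord (character k Δ u) (chartι k Δ.zeroCone y) = 0 := by
  refine ord_specToFunctionField_of_notMem (chartι k Δ.zeroCone) fun h => ?_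
  -- On the torus `x^u` is invertible, with inverse `x^(-u)`.
  refine (pointIdeal_isPrime y).ne_top (Ideal.eq_top_of_isUnit_mem _ h (.of_mul_eq_one
    (AddMonoidAlgebra.single (⟨-u, mem_dualMonoid_bot _⟩ : dualMonoid Δ.zeroCone.1) 1) ?_))
  rw [AddMonoidAlgebra.single_mul_single, AddMonoidAlgebra.one_def, one_mul]
  congr 1
  ext1
  simp

/-- Both sides are additive in `u`. A character with `⟨u, v⟩ = 0` is a unit at the generic point of
`Y(v)`, and one with `⟨m, v⟩ = 1`, which exists as `v` is primitive, is a uniformizer. These cases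
suffice, since `u - ⟨u, v⟩ m` vanishes on `v`. -/
lemma ord_character_rayDivisor (ρ : Δ.Ray) (u : DualLattice N) :
    (toricVariety k Δ).ord (character k Δ u) (rayDivisor k ρ).1 = u ρ.gen := by
  have h0 : ∀ w : DualLattice N, w ρ.gen = 0 → characterOrd (rayDivisor k ρ) w = 0 := by
    intro w hw
    change (toricVariety k Δ).ord (character k Δ w) _ = 0
    rw [character_eq (σ := ρ.cone) (mem_dualMonoid_rayCone.2 hw.ge)]
    refine ord_specToFunctionField_of_notMem (chartι k ρ.cone) fun h => ?_
    have h : AddMonoidAlgebra.single (⟨w, mem_dualMonoid_rayCone.2 hw.ge⟩ :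
      dualMonoid (rayCone ρ.gen)) (1 : k) ∈ rayIdeal k ρ.gen := h
    have := mem_rayIdeal_iff.1 h ⟨w, mem_dualMonoid_rayCone.2 hw.ge⟩ hw
    rw [AddMonoidAlgebra.coeff_single, Finsupp.single_eq_same] at this
    exact one_ne_zero this
  obtain ⟨m, hm⟩ := ρ.isPrimitive.exists_eq_one
  have h1 : characterOrd (rayDivisor k ρ) m = 1 := by
    change (toricVariety k Δ).ord (character k Δ m) _ = 1
    have hmem : m ∈ dualMonoid (rayCone ρ.gen) := mem_dualMonoid_rayCone.2 (by omega)
    rw [character_eq (σ := ρ.cone) hmem]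
    exact ord_specToFunctionField_of_eq_span (chartι k ρ.cone) (rayDivisor k ρ).2
      (rayIdeal_eq_span (m := ⟨m, hmem⟩) hm)
  have h2 := h0 (u - u ρ.gen • m) (by simp [hm])
  rw [map_sub, map_zsmul, h1, smul_eq_mul, mul_one, sub_eq_zero] at h2
  exact h2

/-- The orders of the characters along `Y(v)` recover the functional `u ↦ ⟨u, v⟩`, hence `v`. -/
lemma rayDivisor_injective : Function.Injective (rayDivisor k (Δ := Δ)) := by
  intro ρ ρ' h
  have key : ∀ u : DualLattice N, u ρ.gen = u ρ'.gen := fun u => by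
    rw [← ord_character_rayDivisor (k := k), h, ord_character_rayDivisor]
  refine Fan.Ray.ext ((Module.finBasis ℤ N).ext_elem fun i => ?_)
  exact key ((Module.finBasis ℤ N).coord i)

lemma rayDivisor_notMem_torus (ρ : Δ.Ray) :
    (rayDivisor k ρ).1 ∉ Set.range (chartι k Δ.zeroCone) := by
  rintro ⟨y, hy⟩
  obtain ⟨m, hm⟩ := ρ.isPrimitive.exists_eq_one
  have h1 := ord_character_torus m y
  rw [hy, ord_character_rayDivisor, hm] at h1
  omega

/-- The prime divisors in the complement of the torus are the divisors of the rays. -/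
lemma exists_rayDivisor_eq (Z : PrimeDivisor (toricVariety k Δ))
    (hZ : Z.1 ∉ Set.range (chartι k Δ.zeroCone)) : ∃ ρ : Δ.Ray, Z = rayDivisor k ρ := by
  classical
  obtain ⟨σ, y, hy⟩ := exists_chartι_eq k Z.1
  have hht : (pointIdeal y).height = 1 := by
    rw [← coheight_eq_height_pointIdeal (chartι k σ), hy, Z.2]
  let P := pointIdeal y
  -- some monomial vanishes along the divisor
  obtain ⟨w, hwσ, hw⟩ : ∃ (w : DualLattice N) (hwσ : w ∈ dualMonoid σ.1),
      AddMonoidAlgebra.single (⟨w, hwσ⟩ : dualMonoid σ.1) (1 : k) ∈ P := by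
    -- Inside `U_σ` the torus is the locus where a single monomial `x^w` is invertible, and `y` lies
    -- outside it.
    obtain ⟨-, w, hwσ, -, hr⟩ := chartFunctor_map k Δ (homOfLE (Δ.zeroCone_le σ))
    refine ⟨w, hwσ, ?_⟩
    by_contra hw
    have hmem : y ∈ Set.range ((chartFunctor k Δ).map (homOfLE (Δ.zeroCone_le σ))) := by
      rw [hr]
      exact hw
    obtain ⟨x, hx⟩ := hmem
    refine hZ ⟨x, ?_⟩
    rw [← hy, ← hx, ← chartFunctor_map_chartι k (homOfLE (Δ.zeroCone_le σ))]
    rfl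
  -- some ray has all its vanishing monomials in the ideal
  obtain ⟨ρ, hρσ, hρ⟩ : ∃ ρ : Δ.Ray, ∃ _ : ρ.cone ≤ σ, ∀ u : dualMonoid σ.1,
      0 < (u : DualLattice N) ρ.gen → AddMonoidAlgebra.single u (1 : k) ∈ P := by
    by_contra! hne
    -- Otherwise each ray of `σ` has a monomial outside `P` that is positive on it. Their product
    -- `x^U` is outside the prime `P`, and `U` is positive on every ray of `σ`. Then `n U - w` lies
    -- in `σ^∨` for large `n`, so `x^w` divides `x^(nU)`, which puts `x^U` in `P`.
    let s : Finset Δ.Ray := Finset.univ.filter (fun ρ => ρ.cone ≤ σ)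
    have hs : ∀ ρ, ρ ∈ s ↔ ρ.cone ≤ σ := fun ρ => by simp [s]
    choose! u hu huP using hne
    have hnn : ∀ (m : dualMonoid σ.1) (ρ : Δ.Ray), ρ.cone ≤ σ → 0 ≤ (m : DualLattice N) ρ.gen :=
      fun m ρ h => mem_dualMonoid_rayCone.1 (dualMonoid_anti (show rayCone ρ.gen ≤ σ.1 from h) m.2)
    let U : dualMonoid σ.1 := ∑ ρ ∈ s, u ρ
    have hUP : AddMonoidAlgebra.single U (1 : k) ∉ P := by
      have : AddMonoidAlgebra.single U (1 : k) = ∏ ρ ∈ s, AddMonoidAlgebra.single (u ρ) (1 : k) := by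
        rw [AddMonoidAlgebra.prod_single, Finset.prod_const_one]
      rw [this, (pointIdeal_isPrime y).prod_mem_iff]
      rintro ⟨ρ, hρ, h⟩
      exact huP ρ ((hs ρ).1 hρ) h
    have hUpos : ∀ ρ : Δ.Ray, ρ.cone ≤ σ → 1 ≤ (U : DualLattice N) ρ.gen := by
      intro ρ hρ
      have h1 : (U : DualLattice N) ρ.gen = ∑ ρ' ∈ s, (u ρ' : DualLattice N) ρ.gen := by
        simp [U]
      have h2 := Finset.single_le_sum (f := fun ρ' => (u ρ' : DualLattice N) ρ.gen)
        (fun ρ' _ => hnn (u ρ') ρ hρ) ((hs ρ).2 hρ)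
      have h3 := hu ρ hρ
      omega
    -- Large enough to dominate `⟨w, v⟩` on every ray of `σ`, since `U` is at least `1` there.
    let n : ℕ := ∑ ρ ∈ s, (w ρ.gen).natAbs
    have hmem : n • (U : DualLattice N) - w ∈ dualMonoid σ.1 := by
      suffices H : ∀ W : DualLattice N, (∀ ρ : Δ.Ray, ρ.cone ≤ σ → 1 ≤ W ρ.gen) →
        n • W - w ∈ dualMonoid σ.1 from H _ hUpos
      intro W hW
      rw [Δ.cone_eq_hull σ, mem_dualMonoid_hull]
      rintro _ ⟨ρ, rfl, hρ⟩
      have h1 : (w ρ.gen).natAbs ≤ n :=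
        Finset.single_le_sum (f := fun ρ => (w ρ.gen).natAbs) (fun _ _ => Nat.zero_le _)
          ((hs ρ).2 hρ)
      have h2 := hW ρ hρ
      have h3 : w ρ.gen ≤ n := by omega
      simp only [LinearMap.sub_apply, LinearMap.smul_apply, nsmul_eq_mul]
      nlinarith
    refine hUP ((pointIdeal_isPrime y).mem_of_pow_mem n ?_)
    have : (AddMonoidAlgebra.single U (1 : k)) ^ n =
        AddMonoidAlgebra.single (⟨_, hmem⟩ : dualMonoid σ.1) (1 : k) *
          AddMonoidAlgebra.single (⟨w, hwσ⟩ : dualMonoid σ.1) (1 : k) := by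
      rw [AddMonoidAlgebra.single_pow, AddMonoidAlgebra.single_mul_single, one_pow, one_mul]
      congr 1
      ext1
      simp
    rw [this]
    exact Ideal.mul_mem_left _ _ hw
  refine ⟨ρ, Subtype.ext ?_⟩
  -- The prime of `Y(v)` in the chart `U_σ` is spanned by monomials that are positive on `ρ`, all of
  -- which lie in `P`. Both primes have height one, so the inclusion is an equality.
  have hle : (rayIdeal k ρ.gen).comap (chartMap k (show rayCone ρ.gen ≤ σ.1 from hρσ)) ≤ P := by
    intro f hf
    rw [Ideal.mem_comap, mem_rayIdeal_iff] at hf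
    rw [← AddMonoidAlgebra.sum_coeff_single f]
    refine Ideal.sum_mem _ fun u hu => ?_
    have h3 : AddMonoidAlgebra.single u (f.coeff u) =
        AddMonoidAlgebra.single 0 (f.coeff u) * AddMonoidAlgebra.single u (1 : k) := by
      rw [AddMonoidAlgebra.single_mul_single, zero_add, mul_one]
    change AddMonoidAlgebra.single u (f.coeff u) ∈ _
    rw [h3]
    refine Ideal.mul_mem_left _ _ (hρ u ?_)
    refine lt_of_le_of_ne (mem_dualMonoid_rayCone.1
      (dualMonoid_anti (show rayCone ρ.gen ≤ σ.1 from hρσ) u.2)) fun h => ?_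
    have h4 := hf (AddSubmonoid.inclusion
      (dualMonoid_anti (show rayCone ρ.gen ≤ σ.1 from hρσ)) u) h.symm
    rw [chartMap_coeff] at h4
    exact Finsupp.mem_support_iff.1 hu h4
  let g : Spec (.of (ChartRing k (rayCone ρ.gen))) ⟶ Spec (.of (ChartRing k σ.1)) :=
    (chartFunctor k Δ).map (homOfLE hρσ : ρ.cone ⟶ σ)
  have hgι : chartι k σ (g (rayPoint ρ.gen)) = (rayDivisor k ρ).1 := by
    have : g ≫ chartι k σ = chartι k ρ.cone :=
      chartFunctor_map_chartι k (homOfLE hρσ : ρ.cone ⟶ σ)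
    change (g ≫ chartι k σ) (rayPoint ρ.gen) = chartι k ρ.cone (rayPoint ρ.gen)
    rw [this]
    rfl
  have hheq : (pointIdeal (g (rayPoint ρ.gen))).height = 1 := by
    rw [← coheight_eq_height_pointIdeal (chartι k σ), hgι, (rayDivisor k ρ).2]
  have hle' : pointIdeal (g (rayPoint ρ.gen)) ≤ P := hle
  have : (pointIdeal (g (rayPoint ρ.gen))).FiniteHeight :=
    ⟨Or.inr (by rw [hheq]; exact ENat.one_ne_top)⟩
  have heq := Ideal.eq_of_le_of_height_le _ hle' (by rw [hheq, hht])
  rw [← hy, ← hgι, pointIdeal_injective heq]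

/-- A rational function without poles on the torus is a Laurent polynomial. -/
lemma exists_torusToFunctionField_eq {f : (toricVariety k Δ).functionField}
    (h : ∀ Z : PrimeDivisor (toricVariety k Δ), Z.1 ∈ Set.range (chartι k Δ.zeroCone) →
      0 ≤ (toricVariety k Δ).ord f Z.1) :
    ∃ r, torusToFunctionField k Δ r = f := by
  have : UniqueFactorizationMonoid (ChartRing k Δ.zeroCone.1) :=
    uniqueFactorizationMonoid_chartRing_bot
  have : IsNoetherianRing (ChartRing k Δ.zeroCone.1) :=
    chartRing_isNoetherian (Δ.rational _ Δ.zeroCone.2)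
  exact exists_specToFunctionField_eq (chartι k Δ.zeroCone) fun y hy => h ⟨_, hy⟩ ⟨y, rfl⟩

/-- The order of vanishing of a Laurent polynomial along the divisor of a ray is at most the order
of each of its monomials. -/
lemma ord_torusToFunctionField_le (ρ : Δ.Ray) (f : ChartRing k Δ.zeroCone.1)
    {u : dualMonoid Δ.zeroCone.1} (hu : f.coeff u ≠ 0) :
    (toricVariety k Δ).ord (torusToFunctionField k Δ f) (rayDivisor k ρ).1 ≤
      (u : DualLattice N) ρ.gen := by
  obtain ⟨u₀, hu₀, hmin⟩ := f.coeff.support.exists_min_image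
    (fun u => (u : DualLattice N) ρ.gen) ⟨u, Finsupp.mem_support_iff.2 hu⟩
  obtain ⟨m, hm⟩ := ρ.isPrimitive.exists_eq_one
  set l := (u₀ : DualLattice N) ρ.gen with hl
  -- Multiplying by `x^(-l m)` shifts the smallest pairing with the ray from `l` to `0`. The product
  -- is regular on the chart of the ray and, because of its term from `u₀`, lies outside the ideal
  -- of `Y(v)`. It has order `0`, so `f` has order exactly `l`.
  let s : dualMonoid Δ.zeroCone.1 := ⟨-(l • m), mem_dualMonoid_bot _⟩
  have hcoeff : ∀ w : dualMonoid Δ.zeroCone.1,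
      (AddMonoidAlgebra.single s (1 : k) * f).coeff (s + w) = f.coeff w := fun w => by
    rw [AddMonoidAlgebra.coeff_single_mul_add, one_mul]
  have hsplit : ∀ w : dualMonoid Δ.zeroCone.1, ∃ w' : dualMonoid Δ.zeroCone.1, w = s + w' :=
    fun w => ⟨⟨w + l • m, mem_dualMonoid_bot _⟩, by ext1; simp [s]⟩
  have hle : Δ.zeroCone ≤ ρ.cone := Δ.zeroCone_le _
  obtain ⟨g, hg⟩ := exists_chartMap_eq (σ := ρ.cone.1) hle
    (AddMonoidAlgebra.single s (1 : k) * f) fun w hw => by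
      obtain ⟨w', rfl⟩ := hsplit w
      rw [hcoeff] at hw
      have h1 := hmin w' (Finsupp.mem_support_iff.2 hw)
      refine mem_dualMonoid_rayCone.2 ?_
      simp [s, hm]
      omega
  have hgmem : g ∉ rayIdeal k ρ.gen := by
    intro hmem
    have hmem' : ((s + u₀ : dualMonoid Δ.zeroCone.1) : DualLattice N) ∈
        dualMonoid (rayCone ρ.gen) := mem_dualMonoid_rayCone.2 (by simp [s, hm, hl])
    have h1 := mem_rayIdeal_iff.1 hmem ⟨_, hmem'⟩ (by simp [s, hm, hl])
    have h2 := chartMap_coeff hle g ⟨_, hmem'⟩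
    rw [hg] at h2
    exact Finsupp.mem_support_iff.1 hu₀ ((hcoeff u₀).symm.trans (h2.trans h1))
  have hf0 : torusToFunctionField k Δ f ≠ 0 := by
    rw [Ne, map_eq_zero_iff _ torusToFunctionField_injective]
    rintro rfl
    simp at hu
  have h1 : (toricVariety k Δ).ord (specToFunctionField (chartι k ρ.cone) g)
      (rayDivisor k ρ).1 = 0 :=
    ord_specToFunctionField_of_notMem (chartι k ρ.cone) hgmem
  have h2 : specToFunctionField (chartι k ρ.cone) g =
      character k Δ (-(l • m)) * torusToFunctionField k Δ f := by
    rw [← specToFunctionField_chartMap hle]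
    exact (congrArg (torusToFunctionField k Δ) hg).trans (map_mul _ _ _)
  rw [h2, Scheme.ord_mul (character_ne_zero _) hf0, ord_character_rayDivisor] at h1
  have h3 := hmin u (Finsupp.mem_support_iff.2 hu)
  simp only [LinearMap.neg_apply, LinearMap.smul_apply, hm, smul_eq_mul, mul_one] at h1
  omega

/-- A torus-invariant divisor has no component that meets the torus. -/
lemma IsTorusInvariant.apply_eq_zero [Infinite k] {D : WeilDivisor (toricVariety k Δ)}
    (hD : IsTorusInvariant D) (Z : PrimeDivisor (toricVariety k Δ))
    (hZ : Z.1 ∈ Set.range (chartι k Δ.zeroCone)) : D Z = 0 := by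
  classical
  by_contra hne
  obtain ⟨y, hy⟩ := hZ
  have hht : (pointIdeal y).height = 1 := by
    rw [← coheight_eq_height_pointIdeal (chartι k Δ.zeroCone), hy, Z.2]
  have hbot : pointIdeal y ≠ ⊥ := by
    intro h
    rw [h, Ideal.height_bot] at hht
    exact zero_ne_one hht
  -- By invariance all translates of `Z` have the coefficient `D Z ≠ 0`. Infinitely many of them
  -- contradict the finite support of `D`.
  obtain ⟨v, hv⟩ := exists_infinite_translates (k := k) hbot (pointIdeal_isPrime y).ne_top
  let x : kˣ → Spec (.of (ChartRing k Δ.zeroCone.1)) := fun c =>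
    Spec.map (CommRingCat.ofHom (chartAction (oneParameter v c) Δ.zeroCone.1).toRingHom) y
  have hx : ∀ c, pointIdeal (x c) =
      (pointIdeal y).comap (chartAction (oneParameter v c) Δ.zeroCone.1) := fun c => rfl
  have hact : ∀ c, torusAction (oneParameter v c) Z.1 = chartι k Δ.zeroCone (x c) := by
    intro c
    rw [← hy]
    have h1 : chartι k Δ.zeroCone ≫ torusAction (oneParameter v c) =
        Spec.map (CommRingCat.ofHom (chartAction (oneParameter v c) Δ.zeroCone.1).toRingHom) ≫
          chartι k Δ.zeroCone := ι_colimMap _ _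
    change (chartι k Δ.zeroCone ≫ torusAction (oneParameter v c)) y = _
    rw [h1]
    rfl
  have hcoh : ∀ c, Order.coheight (chartι k Δ.zeroCone (x c)) = 1 := by
    intro c
    rw [coheight_eq_height_pointIdeal, hx]
    -- A translate is again a prime divisor, because automorphisms preserve height.
    exact (RingEquiv.height_comap (oneParameterEquiv v c Δ.zeroCone.1) (pointIdeal y)).trans hht
  refine hv ?_
  have hfin : (chartι k Δ.zeroCone ⁻¹' (Subtype.val '' (D.support : Set (PrimeDivisor _)))).Finite :=
    ((D.support.finite_toSet).image _).preimage
      (chartι k Δ.zeroCone).isOpenEmbedding.injective.injOn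
  refine (hfin.image pointIdeal).subset ?_
  rintro _ ⟨c, rfl⟩
  refine ⟨x c, ⟨⟨_, hcoh c⟩, ?_, rfl⟩, rfl⟩
  rw [Finset.mem_coe, Finsupp.mem_support_iff, hD (oneParameter v c) Z ⟨_, hcoh c⟩ (hact c)]
  exact hne

end ToricCharts

/-! ### Monomial bases of the sections and of the graded piece -/

section CoxRing

variable {k : Type u} [Field k] {N : Type} [AddCommGroup N] [Module.Finite ℤ N] [Module.Free ℤ N]
  {Δ : Fan N}

/-- The lattice points of the polyhedron of a divisor. -/
def polyhedronPoints (D : WeilDivisor (toricVariety k Δ)) : Set (DualLattice N) :=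
  {u | ∀ ρ : Δ.Ray, 0 ≤ u ρ.gen + D (rayDivisor k ρ)}

/-- The characters are the images of the monomial basis of `k[M]` under an injective linear map. -/
lemma linearIndependent_character : LinearIndependent k (character k Δ) := by
  have h1 : LinearIndependent k (fun u : dualMonoid Δ.zeroCone.1 =>
      (AddMonoidAlgebra.single u 1 : ChartRing k Δ.zeroCone.1)) :=
    LinearIndependent.of_comp (AddMonoidAlgebra.coeffLinearEquiv k).toLinearMap
      (Finsupp.linearIndependent_single_one k _)
  have h2 := h1.map' (torusToFunctionFieldₗ k Δ)
    (LinearMap.ker_eq_bot.2 torusToFunctionField_injective)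
  exact h2.comp (fun u => ⟨u, mem_dualMonoid_bot u⟩) fun u w h => congrArg Subtype.val h

variable {D : WeilDivisor (toricVariety k Δ)}

/-- The exponent of the Cox monomial of a character. -/
def coxExponent (D : WeilDivisor (toricVariety k Δ)) (u : DualLattice N) : Δ.Ray →₀ ℕ :=
  Finsupp.equivFunOnFinite.symm fun ρ => (u ρ.gen + D (rayDivisor k ρ)).toNat

/-- On the polyhedron the truncation `Int.toNat` loses nothing. -/
lemma coxExponent_apply {u : DualLattice N} (hu : u ∈ polyhedronPoints D) (ρ : Δ.Ray) :
    (coxExponent D u ρ : ℤ) = u ρ.gen + D (rayDivisor k ρ) :=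
  Int.toNat_of_nonneg (hu ρ)

/-- Non-degeneracy enters through this lemma: two lattice points with the same exponents agree on
all rays, hence everywhere. -/
lemma coxExponent_injective (hΔ : Δ.IsNondegenerate) :
    Function.Injective fun u : polyhedronPoints D => coxExponent D u := by
  intro u w h
  refine Subtype.ext (hΔ.eq_of_rays fun ρ => ?_)
  have h1 := coxExponent_apply u.2 ρ
  have h2 := coxExponent_apply w.2 ρ
  have h3 : coxExponent D u = coxExponent D w := h
  rw [h3] at h1
  omega

/-- The torus-invariant divisor with given coefficients along the divisors of the rays. -/
def rayDivisorSum (k : Type u) [Field k] (d : Δ.Ray →₀ ℕ) : WeilDivisor (toricVariety k Δ) :=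
  ∑ ρ, (d ρ) • Finsupp.single (rayDivisor k ρ) 1

lemma rayDivisorSum_rayDivisor (d : Δ.Ray →₀ ℕ) (ρ : Δ.Ray) :
    rayDivisorSum k d (rayDivisor k ρ) = d ρ := by
  classical
  rw [rayDivisorSum, Finsupp.finsetSum_apply, Finset.sum_eq_single ρ]
  · simp
  · intro ρ' _ h
    rw [Finsupp.smul_apply, Finsupp.single_apply, if_neg (fun h' => h (rayDivisor_injective h')),
      smul_zero]
  · simp

lemma rayDivisorSum_of_mem_torus (d : Δ.Ray →₀ ℕ) (Z : PrimeDivisor (toricVariety k Δ))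
    (hZ : Z.1 ∈ Set.range (chartι k Δ.zeroCone)) : rayDivisorSum k d Z = 0 := by
  classical
  rw [rayDivisorSum, Finsupp.finsetSum_apply]
  refine Finset.sum_eq_zero fun ρ _ => ?_
  rw [Finsupp.smul_apply, Finsupp.single_apply, if_neg, smul_zero]
  rintro rfl
  exact rayDivisor_notMem_torus ρ hZ

/-- Turns the grading into a statement about linear equivalence of divisors. -/
lemma weight_coxDegree (d : Δ.Ray →₀ ℕ) :
    Finsupp.weight (coxDegree k) d =
      (QuotientAddGroup.mk (rayDivisorSum k d) : DivisorClassGroup (toricVariety k Δ)) := by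
  rw [Finsupp.weight_apply, Finsupp.sum_fintype _ (fun i c => c • coxDegree k i) (fun _ => zero_nsmul _),
    rayDivisorSum, ← QuotientAddGroup.mk'_apply, map_sum]
  rfl

lemma linearIndependent_monomial_coxExponent (hΔ : Δ.IsNondegenerate) :
    LinearIndependent k (fun u : polyhedronPoints D =>
      (MvPolynomial.monomial (coxExponent D u) 1 : CoxRing k Δ)) := by
  have h := (MvPolynomial.basisMonomials Δ.Ray k).linearIndependent.comp _
    (coxExponent_injective (D := D) hΔ)
  rwa [MvPolynomial.coe_basisMonomials] at h

lemma monomial_coxExponent (u : DualLattice N) :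
    (MvPolynomial.monomial (coxExponent D u) 1 : CoxRing k Δ) =
      ∏ ρ : Δ.Ray, MvPolynomial.X ρ ^ (u ρ.gen + D (rayDivisor k ρ)).toNat := by
  rw [MvPolynomial.monomial_eq, map_one, one_mul, Finsupp.prod_fintype _ _ (fun _ => pow_zero _)]
  rfl

variable [Infinite k]

/-- Only the ray divisors impose a condition: on a divisor that meets the torus both the order of
`x^u` and the coefficient of `D` vanish. -/
lemma character_effective_iff (hD : IsTorusInvariant D) (u : DualLattice N) :
    (∀ Z : PrimeDivisor (toricVariety k Δ),
      0 ≤ (toricVariety k Δ).ord (character k Δ u) Z.1 + D Z) ↔ u ∈ polyhedronPoints D := by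
  refine ⟨fun h ρ => ?_, fun h Z => ?_⟩
  · rw [← ord_character_rayDivisor (k := k)]
    exact h _
  · by_cases hZ : Z.1 ∈ Set.range (chartι k Δ.zeroCone)
    · rw [hD.apply_eq_zero Z hZ]
      obtain ⟨y, hy⟩ := hZ
      rw [← hy, ord_character_torus, add_zero]
    · obtain ⟨ρ, rfl⟩ := exists_rayDivisor_eq Z hZ
      rw [ord_character_rayDivisor]
      exact h ρ

/-- The global sections of `𝒪(D)` are spanned by the characters in the polyhedron of `D`. -/
lemma span_character_eq_globalSections (hD : IsTorusInvariant D) :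
    Submodule.span k (Set.range fun u : polyhedronPoints D => character k Δ u) =
      globalSections D := by
  apply le_antisymm
  · refine Submodule.span_le.2 ?_
    rintro _ ⟨u, rfl⟩
    exact mem_globalSections.2 (Or.inr ((character_effective_iff hD _).2 u.2))
  · intro f hf
    rcases mem_globalSections.1 hf with rfl | hf
    · exact zero_mem _
    -- `D` has no component on the torus, so `f` has no poles there and is a Laurent polynomial.
    obtain ⟨r, rfl⟩ := exists_torusToFunctionField_eq (f := f) fun Z hZ => by
      have := hf Z
      rwa [hD.apply_eq_zero Z hZ, add_zero] at this
    have hr : torusToFunctionField k Δ r = torusToFunctionFieldₗ k Δ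
        (r.coeff.sum AddMonoidAlgebra.single) := by
      rw [AddMonoidAlgebra.sum_coeff_single]
      rfl
    rw [hr, Finsupp.sum, map_sum]
    refine Submodule.sum_mem _ fun u hu => ?_
    -- The inequality for `f` passes to each of its monomials, whose order along the ray is at least
    -- that of `f`.
    have hmem : (u : DualLattice N) ∈ polyhedronPoints D := fun ρ =>
      (hf (rayDivisor k ρ)).trans (add_le_add_left
        (ord_torusToFunctionField_le ρ r (Finsupp.mem_support_iff.1 hu)) _)
    have h1 : AddMonoidAlgebra.single u (r.coeff u) =
        r.coeff u • (AddMonoidAlgebra.single u 1 : ChartRing k Δ.zeroCone.1) := by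
      rw [AddMonoidAlgebra.smul_single, smul_eq_mul, mul_one]
    rw [h1, map_smul]
    exact Submodule.smul_mem _ _ (Submodule.subset_span ⟨⟨u, hmem⟩, rfl⟩)

/-- The monomials of degree `[D]` are those of the characters in the polyhedron of `D`. -/
lemma weight_coxDegree_eq_iff (hD : IsTorusInvariant D) (d : Δ.Ray →₀ ℕ) :
    Finsupp.weight (coxDegree k) d =
      (QuotientAddGroup.mk D : DivisorClassGroup (toricVariety k Δ)) ↔
      ∃ u ∈ polyhedronPoints D, coxExponent D u = d := by
  rw [weight_coxDegree, eq_comm, QuotientAddGroup.eq]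
  constructor
  · rintro ⟨f, hf0, hf⟩
    -- Here `div(f) = ∑ d_i Y(v_i) - D`, and neither divisor on the right has a component that meets
    -- the torus. So `f` and `f⁻¹` are both Laurent polynomials, and `f` is a unit of `k[M]`.
    have htorus : ∀ Z : PrimeDivisor (toricVariety k Δ), Z.1 ∈ Set.range (chartι k Δ.zeroCone) →
        (toricVariety k Δ).ord f Z.1 = 0 := by
      intro Z hZ
      rw [← hf Z, Finsupp.add_apply, Finsupp.neg_apply, hD.apply_eq_zero Z hZ,
        rayDivisorSum_of_mem_torus d Z hZ, neg_zero, add_zero]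
    have hinv : ∀ Z : PrimeDivisor (toricVariety k Δ),
        (toricVariety k Δ).ord f Z.1 + (toricVariety k Δ).ord f⁻¹ Z.1 = 0 := by
      intro Z
      rw [← Scheme.ord_mul hf0 (inv_ne_zero hf0), mul_inv_cancel₀ hf0, ← character_zero]
      exact (characterOrd Z).map_zero
    obtain ⟨r, hr⟩ := exists_torusToFunctionField_eq (f := f) fun Z hZ => (htorus Z hZ).ge
    obtain ⟨r', hr'⟩ := exists_torusToFunctionField_eq (f := f⁻¹) fun Z hZ => by
      have h1 := hinv Z
      rw [htorus Z hZ] at h1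
      omega
    have hrr : r * r' = 1 := torusToFunctionField_injective (by
      rw [map_mul, hr, hr', mul_inv_cancel₀ hf0, map_one])
    obtain ⟨u, c, hc, rfl⟩ := exists_eq_single_of_mul_eq_one_chartRing hrr
    obtain ⟨u', c', hc', rfl⟩ := exists_eq_single_of_mul_eq_one_chartRing
      ((mul_comm _ _).trans hrr)
    -- The upper bound by monomials, applied to `f = c x^u` and to `f⁻¹ = c' x^(-u)`, bounds the
    -- order from both sides.
    have hord : ∀ ρ : Δ.Ray, (toricVariety k Δ).ord f (rayDivisor k ρ).1 =
        (u : DualLattice N) ρ.gen := by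
      intro ρ
      have h1 := ord_torusToFunctionField_le ρ _
        (show (AddMonoidAlgebra.single u c : ChartRing k Δ.zeroCone.1).coeff u ≠ 0 by
          simpa [AddMonoidAlgebra.coeff_single] using hc)
      have h2 := ord_torusToFunctionField_le ρ _
        (show (AddMonoidAlgebra.single u' c' : ChartRing k Δ.zeroCone.1).coeff u' ≠ 0 by
          simpa [AddMonoidAlgebra.coeff_single] using hc')
      have h3 := hinv (rayDivisor k ρ)
      have h4 : (u : DualLattice N) + u' = 0 := by
        rw [AddMonoidAlgebra.single_mul_single, AddMonoidAlgebra.one_def] at hrr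
        have := congrArg (fun f => f.coeff (u + u')) hrr
        by_contra h5
        have h6 : (0 : dualMonoid Δ.zeroCone.1) ≠ u + u' := fun h => h5 (congrArg Subtype.val h).symm
        simp only [AddMonoidAlgebra.coeff_single, Finsupp.single_eq_same] at this
        rw [Finsupp.single_eq_of_ne h6.symm] at this
        exact mul_ne_zero hc hc' this
      have h5 : (u : DualLattice N) ρ.gen + (u' : DualLattice N) ρ.gen = 0 := by
        rw [← LinearMap.add_apply, h4, LinearMap.zero_apply]
      rw [hr] at h1
      rw [hr'] at h2
      omega
    have hval : ∀ ρ : Δ.Ray, (d ρ : ℤ) = (u : DualLattice N) ρ.gen + D (rayDivisor k ρ) := by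
      intro ρ
      have h1 := hf (rayDivisor k ρ)
      rw [Finsupp.add_apply, Finsupp.neg_apply, rayDivisorSum_rayDivisor, hord] at h1
      omega
    have hu : (u : DualLattice N) ∈ polyhedronPoints D := fun ρ => by
      rw [← hval]
      exact Int.natCast_nonneg _
    refine ⟨u, hu, Finsupp.ext fun ρ => ?_⟩
    have h1 := coxExponent_apply hu ρ
    rw [← hval] at h1
    exact_mod_cast h1
  · rintro ⟨u, hu, rfl⟩
    refine ⟨character k Δ u, character_ne_zero u, fun Z => ?_⟩
    rw [Finsupp.add_apply, Finsupp.neg_apply]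
    by_cases hZ : Z.1 ∈ Set.range (chartι k Δ.zeroCone)
    · rw [hD.apply_eq_zero Z hZ, rayDivisorSum_of_mem_torus _ Z hZ]
      obtain ⟨y, hy⟩ := hZ
      rw [← hy, ord_character_torus]
      rfl
    · obtain ⟨ρ, rfl⟩ := exists_rayDivisor_eq Z hZ
      rw [ord_character_rayDivisor, rayDivisorSum_rayDivisor, coxExponent_apply hu]
      omega

/-- The graded piece of degree `[D]` is spanned by the monomials of the characters in the polyhedron
of `D`. -/
lemma span_monomial_eq_coxGradedPiece (hD : IsTorusInvariant D) :
    Submodule.span k (Set.range fun u : polyhedronPoints D =>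
      (MvPolynomial.monomial (coxExponent D u) 1 : CoxRing k Δ)) =
      coxGradedPiece (QuotientAddGroup.mk D : DivisorClassGroup (toricVariety k Δ)) := by
  apply le_antisymm
  · refine Submodule.span_le.2 ?_
    rintro _ ⟨u, rfl⟩
    exact MvPolynomial.isWeightedHomogeneous_monomial _ _ _
      ((weight_coxDegree_eq_iff hD _).2 ⟨u, u.2, rfl⟩)
  · intro p hp
    have hp : MvPolynomial.IsWeightedHomogeneous (coxDegree k) p _ := hp
    rw [← MvPolynomial.support_sum_monomial_coeff p]
    refine Submodule.sum_mem _ fun d hd => ?_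
    -- Every monomial that occurs in `p` has degree `[D]`, so it comes from a point of the
    -- polyhedron.
    obtain ⟨u, hu, rfl⟩ := (weight_coxDegree_eq_iff hD d).1 (hp (MvPolynomial.mem_support_iff.1 hd))
    have h1 : MvPolynomial.monomial (coxExponent D u) (p.coeff (coxExponent D u)) =
        p.coeff (coxExponent D u) • (MvPolynomial.monomial (coxExponent D u) 1 : CoxRing k Δ) := by
      rw [MvPolynomial.smul_monomial, smul_eq_mul, mul_one]
    rw [h1]
    exact Submodule.smul_mem _ _ (Submodule.subset_span ⟨⟨u, hu⟩, rfl⟩)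

/-- The basis of `H⁰(X, 𝒪(D))` given by the characters in the polyhedron of `D`. -/
def globalSectionsBasis (hD : IsTorusInvariant D) :
    Module.Basis (polyhedronPoints D) k (globalSections D) :=
  (Module.Basis.span (linearIndependent_character.comp _ Subtype.val_injective)).map
    (LinearEquiv.ofEq _ _ (span_character_eq_globalSections hD))

lemma globalSectionsBasis_apply (hD : IsTorusInvariant D) (u : polyhedronPoints D) :
    (globalSectionsBasis hD u : (toricVariety k Δ).functionField) = character k Δ u := by
  rw [globalSectionsBasis, Module.Basis.map_apply, LinearEquiv.coe_ofEq_apply,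
    Module.Basis.span_apply]
  rfl

/-- The basis of the graded piece of degree `[D]` of the Cox ring given by its monomials. -/
def coxGradedPieceBasis (hΔ : Δ.IsNondegenerate) (hD : IsTorusInvariant D) :
    Module.Basis (polyhedronPoints D) k
      (coxGradedPiece (QuotientAddGroup.mk D : DivisorClassGroup (toricVariety k Δ))) :=
  (Module.Basis.span (linearIndependent_monomial_coxExponent hΔ)).map
    (LinearEquiv.ofEq _ _ (span_monomial_eq_coxGradedPiece hD))

lemma coxGradedPieceBasis_apply (hΔ : Δ.IsNondegenerate) (hD : IsTorusInvariant D)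
    (u : polyhedronPoints D) :
    (coxGradedPieceBasis hΔ hD u : CoxRing k Δ) = MvPolynomial.monomial (coxExponent D u) 1 := by
  rw [coxGradedPieceBasis, Module.Basis.map_apply, LinearEquiv.coe_ofEq_apply,
    Module.Basis.span_apply]

end CoxRing
end Toric
end

/-! ### The isomorphism and its uniqueness -/

open AlgebraicGeometry Toric in
theorem mainTheorem2 {k : Type*} [Field k] [IsAlgClosed k]
    {N : Type} [AddCommGroup N] [Module.Free ℤ N] [Module.Finite ℤ N]
    (Δ : Fan N) (hΔ : Δ.IsNondegenerate)
    (D : WeilDivisor (toricVariety k Δ)) (hD : IsTorusInvariant D) :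
    ∃! e : globalSections D ≃ₗ[k]
        coxGradedPiece (QuotientAddGroup.mk D : DivisorClassGroup (toricVariety k Δ)),
      ∀ (u : DualLattice N)
        (hu : ∀ Z : PrimeDivisor (toricVariety k Δ),
          0 ≤ (toricVariety k Δ).ord (character k Δ u) Z.1 + D Z),
        (∀ ρ : Δ.Ray, 0 ≤ u ρ.gen + D (rayDivisor k ρ)) ∧
        (e ⟨character k Δ u, mem_globalSections.2 (Or.inr hu)⟩ : CoxRing k Δ) =
          ∏ ρ : Δ.Ray, MvPolynomial.X ρ ^ (u ρ.gen + D (rayDivisor k ρ)).toNat := by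
  let b := globalSectionsBasis hD
  have hb : ∀ (u : DualLattice N) (hu : u ∈ polyhedronPoints D)
      (hu' : character k Δ u ∈ globalSections D),
      (⟨character k Δ u, hu'⟩ : globalSections D) = b ⟨u, hu⟩ := fun u hu hu' =>
    Subtype.ext (globalSectionsBasis_apply hD ⟨u, hu⟩).symm
  -- Both bases are indexed by the polyhedron points, so the identity of the index set induces the
  -- isomorphism.
  refine ⟨b.equiv (coxGradedPieceBasis hΔ hD) (Equiv.refl _), fun u hu => ?_, fun e he => ?_⟩
  · have hu' := (character_effective_iff hD u).1 hu
    refine ⟨hu', ?_⟩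
    rw [hb u hu', Module.Basis.equiv_apply, Equiv.refl_apply, coxGradedPieceBasis_apply,
      monomial_coxExponent]
  -- The prescribed values determine `e` on the basis of characters.
  · refine LinearEquiv.toLinearMap_injective (b.ext fun u => Subtype.ext ?_)
    have h1 := (he u ((character_effective_iff hD _).2 u.2)).2
    rw [hb u u.2] at h1
    refine h1.trans ?_
    rw [LinearEquiv.coe_coe, Module.Basis.equiv_apply, Equiv.refl_apply,
      coxGradedPieceBasis_apply, monomial_coxExponent]
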